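/- \textbf{Conventions.} For $d\ge 1$ let $\mathcal P_d(\mathbb R)$ be the set of monic real polynomials of degree $d$ all of whose roots are real. Write a real polynomial $p$ that is monic of degree $d$ as $p(x)=\sum_{k=0}^d x^{d-k}(-1)^k\binom dk \widetilde e_k(p)$ and put $$[p\boxtimes_d q](x)=\sum_{k=0}^d x^{d-k}(-1)^k\binom dk\,\widetilde e_k(p)\,\widetilde e_k(q).$$ Let $m_n(p)=\frac1d\sum_{i=1}^d\lambda_i(p)^n$, where $\lambda_1(p),\dots,\lambda_d(p)$ are the roots of $p$ in $\mathbb C$ with multiplicity. An \emph{infinitesimal distribution} is a pair $(\mu,\mu')$ of a probability measure $\mu$ on $\mathbb R$ with finite moments $m_n(\mu)=\int t^n\,d\mu(t)$ of all orders and a linear functional $\mu':\mathbb R[x]\to\mathbb R$ with $\mu'(1)=0$; put $m_n(\mu')=\mu'(x^n)$. A sequence $(p_d)_{d\ge1}$ of real polynomials, $p_d$ monic of degree $d$, \emph{has infinitesimal distribution} $(\mu,\mu')$ if, for every $n\ge 0$, $$m_n(p_d)\to m_n(\mu)\qquad\text{and}\qquad d\,\bigl(m_n(p_d)-m_n(\mu)\bigr)\to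 m_n(\mu')\qquad\text{as } d\to\infty .$$ For a set partition $\pi$ of $[n]$ and a sequence $(u_k)$ let $u_\pi=\prod_{V\in\pi}u_{|V|}$ and $u_{\pi\setminus V}=\prod_{W\in\pi,\,W\ne V}u_{|W|}$. Let $NC(n)$ be the set of non-crossing partitions of $[n]$ and $Kr(\pi)$ the Kreweras complement of $\pi$, i.e. the partition into the cycles of $\pi^{-1}(1,2,\dots,n)$, where $\pi$ is viewed as the permutation whose cycles are its blocks in increasing order. The free cumulants $r_n(\mu)$ and the infinitesimal free cumulants $r'_n(\mu,\mu')$ are defined recursively, for $n\ge1$, by $$m_n(\mu)=\sum_{\pi\in NC(n)}r_\pi(\mu),\qquad m_n(\mu')=\sum_{\pi\in NC(n)}\sum_{V\in\pi}r'_{|V|}(\mu,\mu')\,r_{\pi\setminus V}(\mu).$$ For infinitesimal distributions $(\mu,\mu')$ and $(\nu,\nu')$ with $\nu$ supported on $[0,\infty)$, an infinitesimal distribution $(\gamma,\gamma')$ is the \emph{infinitesimal free multiplicative convolution} $(\mu,\mu')\boxtimes_B(\nu,\nu')$ if, for all $n\ge1$, $$r_n(\gamma)=\sum_{\pi\in NC(n)}r_\pi(\mu)\,r_{Kr(\pi)}(\nu)$$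 (that is, $\gamma=\mu\boxtimes\nu$) and $$r'_n(\gamma,\gamma')=\sum_{\pi\in NC(n)}\Bigl(\sum_{V\in\pi}r'_{|V|}(\mu,\mu')\,r_{\pi\setminus V}(\mu)\,r_{Kr(\pi)}(\nu)+\sum_{W\in Kr(\pi)}r_\pi(\mu)\,r'_{|W|}(\nu,\nu')\,r_{Kr(\pi)\setminus W}(\nu)\Bigr).$$ \textbf{Proposition.} Let $(p_d)_{d\ge1}$ and $(q_d)_{d\ge1}$, with $p_d,q_d\in\mathcal P_d(\mathbb R)$ for every $d\ge 1$, have infinitesimal distributions $(\mu,\mu')$ and $(\nu,\nu')$, respectively. If $\nu=\delta_1$, then $(\mu,\mu')\boxtimes_B(\nu,\nu')$ exists, and whenever $(\gamma,\gamma')=(\mu,\mu')\boxtimes_B(\nu,\nu')$, the sequence of finite-free multiplicative convolutions $(p_d\boxtimes_d q_d)_{d\ge1}$ has infinitesimal distribution $(\gamma,\gamma')$. -/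

import Mathlib

/-!
Let `P_d` and `R_d` be the reversed polynomials of `p_d` and `p_d ⊠_d q_d`. By Newton's identities
`-P_d' / P_d` is the generating series of the power sums of the roots of `p_d`, so
`-d⁻¹ x P_d' / P_d` tends to `M = ∑_{n ≥ 1} m_n(μ) x ^ n`. Expanding `q_d` in powers of `x - 1`,
with reversed coefficients `a_j`, turns the convolution into the differential operator
`R_d = ∑_j (-1) ^ j a_j x ^ j P_d^{(j)} / (d (d - 1) ⋯ (d - j + 1))`. Since `ν = δ₁`, the `a_j` stay
bounded: they converge to the coefficients of a series `a` with
`-a' / a = κ = ∑_n ν'((x - 1) ^ {n + 1}) x ^ n`. Hence `R_d / P_d → a(M)`, and the negative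
logarithmic derivative `κ(M) M'` of this limit is the generating series of the differences of the
infinitesimal moments.

On the free side, `δ₁` has the cumulants `1, 0, 0, …` and the infinitesimal cumulants
`ν'((x - 1) ^ n)`. The only non-crossing partitions that contribute to `r'_n(γ, γ')` are then `1_n`
and those whose Kreweras complement has a single non-trivial block `W`; these are the partitions of
the circle into the runs between consecutive elements of `W`. Summing the resulting cumulants over
the blocks of all non-crossing partitions gives `κ(M) M'` again, by the functional equation
`M(x) = C(x (1 + M(x)))` between the moment series and the cumulant series `C`.
-/

open Polynomial MeasureTheory Filter Topology Finset

namespace FiniteFree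

/-! ### Non-crossing partitions of `[n]`, modelled on `Fin n` -/

/-- Set partitions `P(n)` of an `n`-element linearly ordered set. -/
abbrev SetPartition (n : ℕ) := Finpartition (Finset.univ : Finset (Fin n))

/-- `π` is non-crossing: if `a < b < c < d` with `a, c` in a block `V` and `b, d` in a block `W`,
then `V = W`. -/
def IsNoncrossing {n : ℕ} (π : SetPartition n) : Prop :=
  ∀ a b c d : Fin n, a < b → b < c → c < d →
    ∀ V ∈ π.parts, ∀ W ∈ π.parts, a ∈ V → c ∈ V → b ∈ W → d ∈ W → V = W

instance {n : ℕ} (π : SetPartition n) : Decidable (IsNoncrossing π) := by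
  unfold IsNoncrossing; infer_instance

/-- The finite set `NC(n)` of non-crossing partitions of `[n]`. -/
def NC (n : ℕ) : Finset (SetPartition n) := Finset.univ.filter fun π => IsNoncrossing π

/-- The permutation attached to a set partition: its cycles are the blocks of `π`, each written in
increasing order. -/
noncomputable def blockPerm {n : ℕ} (π : SetPartition n) : Equiv.Perm (Fin n) :=
  Equiv.ofBijective (fun i => ((π.part i).sort (· ≤ ·)).formPerm i) <| by
    have key : ∀ i : Fin n, ((π.part i).sort (· ≤ ·)).formPerm i ∈ π.part i := fun i => by
      have h : i ∈ (π.part i).sort (· ≤ ·) :=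
        (Finset.mem_sort _).2 (π.mem_part (Finset.mem_univ i))
      exact (Finset.mem_sort _).1 (List.formPerm_apply_mem_of_mem h)
    refine Finite.injective_iff_bijective.1 fun i j hij => ?_
    have hij' : ((π.part i).sort (· ≤ ·)).formPerm i = ((π.part j).sort (· ≤ ·)).formPerm j := hij
    have hi := key i
    have hj := key j
    rw [← hij'] at hj
    have hp : π.part i = π.part j :=
      (π.part_eq_of_mem (π.part_mem.2 (Finset.mem_univ i)) hi).symm.trans
        (π.part_eq_of_mem (π.part_mem.2 (Finset.mem_univ j)) hj)
    rw [hp] at hij'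
    exact Equiv.injective _ hij'

/-- The set partition of `[n]` into the cycles (fixed points included) of a permutation. -/
def cyclePartition {n : ℕ} (σ : Equiv.Perm (Fin n)) : SetPartition n :=
  letI : DecidableRel (Equiv.Perm.SameCycle.setoid σ).r := fun a b =>
    inferInstanceAs (Decidable (σ.SameCycle a b))
  Finpartition.ofSetoid (Equiv.Perm.SameCycle.setoid σ)

/-- The Kreweras complement `Kr(π)`: the cycles of `π⁻¹ γₙ`, with `γₙ = (1, 2, …, n)`. -/
noncomputable def kreweras {n : ℕ} (π : SetPartition n) : SetPartition n :=
  cyclePartition ((blockPerm π)⁻¹ * finRotate n)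

/-- `u_π = ∏_{V ∈ π} u_{|V|}`. -/
def blockProd (u : ℕ → ℝ) {n : ℕ} (π : SetPartition n) : ℝ :=
  ∏ V ∈ π.parts, u V.card

/-- `∑_{V ∈ π} u'_{|V|} u_{π ∖ V}`, with `u_{π ∖ V} = ∏_{W ∈ π, W ≠ V} u_{|W|}`. -/
def blockDeriv (u u' : ℕ → ℝ) {n : ℕ} (π : SetPartition n) : ℝ :=
  ∑ V ∈ π.parts, u' V.card * ∏ W ∈ π.parts.erase V, u W.card

/-! ### Free cumulants and infinitesimal free cumulants -/

/-- The free cumulants `r_n` of a sequence of moments `m_n`, defined recursively by solving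
the moment-cumulant formula `m_n = ∑_{π ∈ NC(n)} r_π` for the summand `r_n` of `π = 1_n`. Every
block of a partition `π ≠ 1_n` has fewer than `n` elements, so the `else` branch does not occur
(see `moment_eq_sum_freeCumulant`). -/
noncomputable def freeCumulant (m : ℕ → ℝ) (n : ℕ) : ℝ :=
  m n - ∑ π ∈ (NC n).erase ⊤, ∏ V ∈ π.parts,
    if _h : V.card < n then freeCumulant m V.card else 0
termination_by n

/-- The infinitesimal free cumulants `r'_n` of a sequence of moments `m_n` and a sequence of
infinitesimal moments `m'_n`, defined recursively by solving the infinitesimal moment-cumulant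
formula `m'_n = ∑_{π ∈ NC(n)} ∑_{V ∈ π} r'_{|V|} r_{π ∖ V}` for the summand `r'_n` of `π = 1_n`
(see `infMoment_eq_sum_infFreeCumulant`). -/
noncomputable def infFreeCumulant (m m' : ℕ → ℝ) (n : ℕ) : ℝ :=
  m' n - ∑ π ∈ (NC n).erase ⊤, ∑ V ∈ π.parts,
    (if _h : V.card < n then infFreeCumulant m m' V.card else 0) *
      ∏ W ∈ π.parts.erase V, freeCumulant m W.card
termination_by n

lemma card_lt_of_ne_top {n : ℕ} {π : SetPartition n} (hπ : π ≠ ⊤) {V : Finset (Fin n)}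
    (hV : V ∈ π.parts) : V.card < n := by
  refine lt_of_le_of_ne (by simpa using Finset.card_le_univ V) fun h => hπ ?_
  have hVu : V = Finset.univ := Finset.eq_univ_of_card V (by simpa using h)
  subst hVu
  refine top_le_iff.1 ?_
  intro W hW
  exact ⟨_, hV, Finset.subset_univ W⟩

lemma top_mem_NC (n : ℕ) : (⊤ : SetPartition n) ∈ NC n := by
  refine Finset.mem_filter.2 ⟨Finset.mem_univ _, ?_⟩
  intro a b c d _ _ _ V hV W hW _ _ _ _
  exact Finset.mem_singleton.1 (Finpartition.parts_top_subset _ hV) |>.trans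
    (Finset.mem_singleton.1 (Finpartition.parts_top_subset _ hW)).symm

lemma parts_top {n : ℕ} (hn : n ≠ 0) : (⊤ : SetPartition n).parts = {Finset.univ} := by
  have : NeZero n := ⟨hn⟩
  have h := Finpartition.parts_top_subset (Finset.univ : Finset (Fin n))
  rcases Finset.subset_singleton_iff.1 h with h0 | h1
  · have h2 := (⊤ : SetPartition n).part_mem.2 (Finset.mem_univ (0 : Fin n))
    rw [h0] at h2
    exact absurd h2 (Finset.notMem_empty _)
  · exact h1

theorem moment_eq_sum_freeCumulant (m : ℕ → ℝ) {n : ℕ} (hn : n ≠ 0) :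
    m n = ∑ π ∈ NC n, blockProd (freeCumulant m) π := by
  rw [← Finset.add_sum_erase _ _ (top_mem_NC n)]
  have h1 : blockProd (freeCumulant m) (⊤ : SetPartition n) = freeCumulant m n := by
    simp [blockProd, parts_top hn]
  rw [h1, freeCumulant]
  have h2 : ∀ π ∈ (NC n).erase ⊤, (∏ V ∈ π.parts,
      if _h : V.card < n then freeCumulant m V.card else 0) = blockProd (freeCumulant m) π := by
    intro π hπ
    refine Finset.prod_congr rfl fun V hV => ?_
    rw [dif_pos (card_lt_of_ne_top (Finset.ne_of_mem_erase hπ) hV)]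
  rw [Finset.sum_congr rfl h2]
  ring

theorem infMoment_eq_sum_infFreeCumulant (m m' : ℕ → ℝ) {n : ℕ} (hn : n ≠ 0) :
    m' n = ∑ π ∈ NC n, blockDeriv (freeCumulant m) (infFreeCumulant m m') π := by
  rw [← Finset.add_sum_erase _ _ (top_mem_NC n)]
  have h1 : blockDeriv (freeCumulant m) (infFreeCumulant m m') (⊤ : SetPartition n)
      = infFreeCumulant m m' n := by
    simp [blockDeriv, parts_top hn]
  rw [h1, infFreeCumulant]
  have h2 : ∀ π ∈ (NC n).erase ⊤, (∑ V ∈ π.parts,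
      (if _h : V.card < n then infFreeCumulant m m' V.card else 0) *
        ∏ W ∈ π.parts.erase V, freeCumulant m W.card)
      = blockDeriv (freeCumulant m) (infFreeCumulant m m') π := by
    intro π hπ
    refine Finset.sum_congr rfl fun V hV => ?_
    rw [dif_pos (card_lt_of_ne_top (Finset.ne_of_mem_erase hπ) hV)]
  rw [Finset.sum_congr rfl h2]
  ring

/-! ### Infinitesimal distributions and their free multiplicative convolution -/

/-- An infinitesimal distribution: a probability measure on `ℝ` with finite moments of all orders
and a linear functional `μ'` on `ℝ[x]` with `μ'(1) = 0`. -/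
structure IsInfDistribution (μ : Measure ℝ) (μ' : ℝ[X] →ₗ[ℝ] ℝ) : Prop where
  isProbabilityMeasure : IsProbabilityMeasure μ
  integrable_pow : ∀ n : ℕ, Integrable (fun t : ℝ => t ^ n) μ
  map_one : μ' 1 = 0

/-- The moments `m_n(μ)` of a measure on `ℝ`. -/
noncomputable def measureMoment (μ : Measure ℝ) (n : ℕ) : ℝ := ∫ t, t ^ n ∂μ

/-- The moments `m_n(μ') = μ'(x^n)` of a linear functional on `ℝ[x]`. -/
noncomputable def functionalMoment (μ' : ℝ[X] →ₗ[ℝ] ℝ) (n : ℕ) : ℝ := μ' (X ^ n)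

/-- The free cumulants `r_n(μ)`. -/
noncomputable def freeCumulants (μ : Measure ℝ) : ℕ → ℝ := freeCumulant (measureMoment μ)

/-- The infinitesimal free cumulants `r'_n(μ, μ')`. -/
noncomputable def infFreeCumulants (μ : Measure ℝ) (μ' : ℝ[X] →ₗ[ℝ] ℝ) : ℕ → ℝ :=
  infFreeCumulant (measureMoment μ) (functionalMoment μ')

/-- `γ` is a free multiplicative convolution `μ ⊠ ν`, where `ν` lives on `[0, ∞)`: a probability
measure with finite moments of all orders such that
`r_n(γ) = ∑_{π ∈ NC(n)} r_π(μ) r_{Kr(π)}(ν)` for all `n ≥ 1`. -/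
structure IsFreeMulConv (μ ν γ : Measure ℝ) : Prop where
  nonneg : ν (Set.Iio 0) = 0
  isProbabilityMeasure : IsProbabilityMeasure γ
  integrable_pow : ∀ n : ℕ, Integrable (fun t : ℝ => t ^ n) γ
  freeCumulants_eq : ∀ n : ℕ, 1 ≤ n → freeCumulants γ n =
    ∑ π ∈ NC n, blockProd (freeCumulants μ) π * blockProd (freeCumulants ν) (kreweras π)

/-- `(γ, γ')` is the infinitesimal free multiplicative convolution `(μ, μ') ⊠_B (ν, ν')`. -/
structure IsInfFreeMulConv (μ : Measure ℝ) (μ' : ℝ[X] →ₗ[ℝ] ℝ) (ν : Measure ℝ)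
    (ν' : ℝ[X] →ₗ[ℝ] ℝ) (γ : Measure ℝ) (γ' : ℝ[X] →ₗ[ℝ] ℝ) : Prop where
  isFreeMulConv : IsFreeMulConv μ ν γ
  map_one : γ' 1 = 0
  infFreeCumulants_eq : ∀ n : ℕ, 1 ≤ n → infFreeCumulants γ γ' n =
    ∑ π ∈ NC n,
      (blockDeriv (freeCumulants μ) (infFreeCumulants μ μ') π *
          blockProd (freeCumulants ν) (kreweras π) +
        blockProd (freeCumulants μ) π *
          blockDeriv (freeCumulants ν) (infFreeCumulants ν ν') (kreweras π))

/-! ### Polynomials and their root distributions -/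

/-- `p ∈ 𝒫_d(ℝ)`: a monic polynomial of degree `d` all of whose roots are real. -/
structure IsRealRooted (d : ℕ) (p : ℝ[X]) : Prop where
  monic : p.Monic
  natDegree_eq : p.natDegree = d
  splits : p.Splits

/-- The coefficients `e_k(p)` in `p(x) = ∑_k x^{d-k} (-1)^k (d choose k) e_k(p)`. -/
noncomputable def normCoeff (d : ℕ) (p : ℝ[X]) (k : ℕ) : ℝ :=
  (-1) ^ k * p.coeff (d - k) / (d.choose k : ℝ)

/-- The finite-free multiplicative convolution `p ⊠_d q`. -/
noncomputable def finiteFreeMulConv (d : ℕ) (p q : ℝ[X]) : ℝ[X] :=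
  ∑ k ∈ Finset.range (d + 1),
    C ((-1) ^ k * (d.choose k : ℝ) * (normCoeff d p k * normCoeff d q k)) * X ^ (d - k)

/-- The `n`-th moment `(1/d) ∑_i λ_i(p)^n` of the root distribution of a real polynomial `p` of
degree `d`, where the sum is over the complex roots of `p` with multiplicity. If `p` is real-rooted
this is the corresponding sum over the real roots (see `rootMoment_of_splits`). -/
noncomputable def rootMoment (d : ℕ) (p : ℝ[X]) (n : ℕ) : ℂ :=
  ((p.map (algebraMap ℝ ℂ)).roots.map fun z => z ^ n).sum / d

theorem rootMoment_of_splits (d : ℕ) {p : ℝ[X]} (hp : p.Splits) (n : ℕ) :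
    rootMoment d p n = (((p.roots.map fun x => x ^ n).sum / d : ℝ) : ℂ) := by
  rw [rootMoment, hp.roots_map (algebraMap ℝ ℂ), Multiset.map_map, Complex.ofReal_div,
    Complex.ofReal_natCast]
  congr 1
  have h := map_multiset_sum (algebraMap ℝ ℂ) (p.roots.map fun x => x ^ n)
  rw [Multiset.map_map] at h
  refine Eq.trans ?_ h.symm
  congr 1
  exact Multiset.map_congr rfl fun x _ => by simp

/-- The sequence `(p_d)_{d ≥ 1}` has infinitesimal distribution `(μ, μ')`: for all `n`,
`m_n(p_d) → m_n(μ)` and `d (m_n(p_d) - m_n(μ)) → μ'(x^n)` as `d → ∞`. -/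
structure HasInfDistribution (p : ℕ → ℝ[X]) (μ : Measure ℝ) (μ' : ℝ[X] →ₗ[ℝ] ℝ) : Prop where
  isInfDistribution : IsInfDistribution μ μ'
  tendsto_moment : ∀ n : ℕ,
    Tendsto (fun d : ℕ => rootMoment d (p d) n) atTop (𝓝 (measureMoment μ n : ℂ))
  tendsto_infMoment : ∀ n : ℕ,
    Tendsto (fun d : ℕ => (d : ℂ) * (rootMoment d (p d) n - (measureMoment μ n : ℂ))) atTop
      (𝓝 (functionalMoment μ' n : ℂ))

end FiniteFree

namespace FiniteFree

open scoped PowerSeries PowerSeries.WithPiTopology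

/-! ### Power series -/

section PowerSeries

lemma coeff_pow_eq_zero_of_lt {A : Type*} [CommSemiring A] {b : A⟦X⟧}
    (hb : PowerSeries.constantCoeff b = 0) {n j : ℕ} (h : n < j) :
    PowerSeries.coeff n (b ^ j) = 0 :=
  PowerSeries.X_pow_dvd_iff.1 (pow_dvd_pow_of_dvd (PowerSeries.X_dvd_iff.2 hb) j) n h

lemma coeff_subst_eq_sum {A : Type*} [CommRing A] {b : A⟦X⟧}
    (hb : PowerSeries.constantCoeff b = 0) (a : A⟦X⟧) (n : ℕ) :
    PowerSeries.coeff n (a.subst b)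
      = ∑ j ∈ range (n + 1), PowerSeries.coeff j a * PowerSeries.coeff n (b ^ j) := by
  rw [PowerSeries.coeff_subst' (PowerSeries.HasSubst.of_constantCoeff_zero' hb),
    finsum_eq_sum_of_support_subset (s := range (n + 1))]
  · rfl
  · intro j hj
    by_contra hjn
    exact hj (by simp only [coeff_pow_eq_zero_of_lt hb (by simpa using hjn), smul_zero])

lemma coeff_subst_mul {A : Type*} [CommRing A] {b : A⟦X⟧}
    (hb : PowerSeries.constantCoeff b = 0) (a f : A⟦X⟧) (n : ℕ) :
    PowerSeries.coeff n (a.subst b * f)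
      = ∑ j ∈ range (n + 1), PowerSeries.coeff j a * PowerSeries.coeff n (b ^ j * f) := by
  have hsum : ∀ x ∈ antidiagonal n, PowerSeries.coeff x.1 (a.subst b)
      = ∑ j ∈ range (n + 1), PowerSeries.coeff j a * PowerSeries.coeff x.1 (b ^ j) := by
    intro x hx
    rw [coeff_subst_eq_sum hb]
    refine Finset.sum_subset
      (range_subset_range.2 (by have := mem_antidiagonal.1 hx; omega)) fun j _ hj => ?_
    rw [coeff_pow_eq_zero_of_lt hb (by simpa using hj), mul_zero]
  simp only [PowerSeries.coeff_mul, Finset.mul_sum, ← mul_assoc]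
  rw [Finset.sum_comm]
  exact Finset.sum_congr rfl fun x hx => by rw [hsum x hx, Finset.sum_mul]

variable {K : Type*} [CommRing K]

/-- The differential operator `X ^ j (d/dX) ^ j` on power series. -/
noncomputable def fallingDerivative (j : ℕ) (f : K⟦X⟧) : K⟦X⟧ :=
  PowerSeries.mk fun k => (k.descFactorial j : K) * PowerSeries.coeff k f

@[simp] lemma coeff_fallingDerivative (j k : ℕ) (f : K⟦X⟧) :
    PowerSeries.coeff k (fallingDerivative j f)
      = (k.descFactorial j : K) * PowerSeries.coeff k f :=
  PowerSeries.coeff_mk _ _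

lemma fallingDerivative_zero (f : K⟦X⟧) : fallingDerivative 0 f = f := by
  ext k; simp

lemma fallingDerivative_one (f : K⟦X⟧) :
    fallingDerivative 1 f = PowerSeries.X * PowerSeries.derivative K f := by
  ext k
  cases k with
  | zero => simp
  | succ k => simp [PowerSeries.coeff_succ_X_mul, PowerSeries.coeff_derivative, mul_comm]

lemma fallingDerivative_succ (j : ℕ) (f : K⟦X⟧) :
    fallingDerivative (j + 1) f
      = fallingDerivative 1 (fallingDerivative j f) - (j : K⟦X⟧) * fallingDerivative j f := by
  ext k
  rw [map_sub, ← nsmul_eq_mul, map_nsmul]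
  simp only [coeff_fallingDerivative, Nat.descFactorial_one, Nat.descFactorial_succ k j,
    nsmul_eq_mul]
  rcases Nat.lt_or_ge k j with hkj | hjk
  · simp [Nat.descFactorial_eq_zero_iff_lt.2 hkj]
  · push_cast [hjk]; ring

lemma fallingDerivative_one_mul (f g : K⟦X⟧) :
    fallingDerivative 1 (f * g) = fallingDerivative 1 f * g + f * fallingDerivative 1 g := by
  simp only [fallingDerivative_one, Derivation.leibniz, smul_eq_mul]; ring

lemma coeff_fallingDerivative_mul_of_lt {n j : ℕ} (hnj : n < j) (f g : K⟦X⟧) :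
    PowerSeries.coeff n (fallingDerivative j f * g) = 0 := by
  refine PowerSeries.X_pow_dvd_iff.1 (dvd_mul_of_dvd_left ?_ g) n hnj
  refine PowerSeries.X_pow_dvd_iff.2 fun k hk => ?_
  rw [coeff_fallingDerivative, Nat.descFactorial_eq_zero_iff_lt.2 hk, Nat.cast_zero, zero_mul]

/-- The generating series `∑_{n ≥ 1} m_n x ^ n`. -/
noncomputable def momentSeries (m : ℕ → K) : K⟦X⟧ :=
  PowerSeries.X * PowerSeries.mk fun n => m (n + 1)

@[simp] lemma constantCoeff_momentSeries (m : ℕ → K) :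
    PowerSeries.constantCoeff (momentSeries m) = 0 := by
  simp [momentSeries]

@[simp] lemma coeff_succ_momentSeries (m : ℕ → K) (n : ℕ) :
    PowerSeries.coeff (n + 1) (momentSeries m) = m (n + 1) := by
  simp [momentSeries, PowerSeries.coeff_succ_X_mul]

end PowerSeries

section Limits

variable {ι : Type*} {l : Filter ι} {K : Type*} [Field K] [TopologicalSpace K]
  [IsTopologicalRing K]

lemma tendsto_powerSeries_derivative {F : ι → K⟦X⟧} {f : K⟦X⟧} (h : Tendsto F l (𝓝 f)) :
    Tendsto (fun i => PowerSeries.derivative K (F i)) l (𝓝 (PowerSeries.derivative K f)) := by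
  rw [PowerSeries.WithPiTopology.tendsto_iff_coeff_tendsto] at h ⊢
  intro n
  simpa only [PowerSeries.coeff_derivative] using (h (n + 1)).mul_const _

lemma tendsto_powerSeries_inv [ContinuousInv₀ K] {F : ι → K⟦X⟧} {f : K⟦X⟧}
    (h : Tendsto F l (𝓝 f)) (h0 : PowerSeries.constantCoeff f ≠ 0) :
    Tendsto (fun i => (F i)⁻¹) l (𝓝 f⁻¹) := by
  have hc := (((PowerSeries.WithPiTopology.continuous_constantCoeff K).tendsto f).comp h).inv₀ h0
  rw [PowerSeries.WithPiTopology.tendsto_iff_coeff_tendsto] at h ⊢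
  intro n
  induction n using Nat.strong_induction_on with
  | _ n ih =>
    simp_rw [PowerSeries.coeff_inv n]
    split_ifs with hn
    · exact hc
    · refine hc.neg.mul (tendsto_finsetSum _ fun x _ => ?_)
      split_ifs with hx
      · exact (h _).mul (ih _ hx)
      · exact tendsto_const_nhds

/-- The limit equation `a' = -a n` determines the coefficients of `a` recursively. -/
lemma exists_tendsto_of_derivative_eq [CharZero K] {A N : ι → K⟦X⟧} {n : K⟦X⟧}
    (h0 : ∀ᶠ i in l, PowerSeries.constantCoeff (A i) = 1)
    (hA : ∀ᶠ i in l, PowerSeries.derivative K (A i) = -(A i * N i)) (hN : Tendsto N l (𝓝 n)) :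
    ∃ a : K⟦X⟧, Tendsto A l (𝓝 a) := by
  simp only [PowerSeries.WithPiTopology.tendsto_iff_coeff_tendsto] at hN ⊢
  suffices hlim : ∀ k, ∃ c, Tendsto (fun i => PowerSeries.coeff k (A i)) l (𝓝 c) by
    choose c hc using hlim
    exact ⟨PowerSeries.mk c, fun k => by simpa only [PowerSeries.coeff_mk] using hc k⟩
  intro k
  induction k using Nat.strong_induction_on with
  | _ k ih =>
    cases k with
    | zero =>
      refine ⟨1, tendsto_const_nhds.congr' ?_⟩
      filter_upwards [h0] with i hi
      rw [PowerSeries.coeff_zero_eq_constantCoeff_apply, hi]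
    | succ k =>
      choose! c hc using ih
      have hsum := tendsto_finsetSum (antidiagonal k) fun x hx =>
        (hc x.1 (Nat.lt_succ_of_le ((mem_antidiagonal.1 hx) ▸ Nat.le_add_right _ _))).mul (hN x.2)
      refine ⟨_, (hsum.neg.div_const ((k : K) + 1)).congr' ?_⟩
      filter_upwards [hA] with i hi
      rw [← PowerSeries.coeff_mul, ← map_neg, ← hi, PowerSeries.coeff_derivative,
        mul_div_cancel_right₀ _ (Nat.cast_add_one_ne_zero k)]

/-- The hypothesis says that `d⁻¹ X P' / P → u`. Each further derivative contributes one more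
factor `d u`, up to terms of lower order in `d`. -/
lemma tendsto_fallingDerivative_mul_inv {P : ℕ → ℝ⟦X⟧} {u : ℝ⟦X⟧}
    (hP : ∀ᶠ d in atTop, PowerSeries.constantCoeff (P d) ≠ 0)
    (hu : Tendsto (fun d : ℕ => PowerSeries.C (d : ℝ)⁻¹ * (fallingDerivative 1 (P d) * (P d)⁻¹))
      atTop (𝓝 u)) (j : ℕ) :
    Tendsto (fun d : ℕ => PowerSeries.C (d : ℝ)⁻¹ ^ j * (fallingDerivative j (P d) * (P d)⁻¹))
      atTop (𝓝 (u ^ j)) := by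
  have hε : Tendsto (fun d : ℕ => PowerSeries.C (d : ℝ)⁻¹) atTop (𝓝 0) := by
    have hC := (PowerSeries.WithPiTopology.continuous_C (R := ℝ)).tendsto 0
    rw [map_zero] at hC
    exact hC.comp tendsto_inv_atTop_nhds_zero_nat
  induction j with
  | zero =>
    refine tendsto_const_nhds.congr' ?_
    filter_upwards [hP] with d hd
    simp [fallingDerivative_zero, PowerSeries.mul_inv_cancel _ hd]
  | succ j ih =>
    set A := fun d : ℕ => PowerSeries.C (d : ℝ)⁻¹ ^ j * (fallingDerivative j (P d) * (P d)⁻¹)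
    have hlim := (ih.mul hu).add (hε.mul
      ((tendsto_powerSeries_derivative ih).const_mul PowerSeries.X |>.sub
        (ih.const_mul (j : ℝ⟦X⟧))))
    rw [zero_mul, add_zero, ← pow_succ] at hlim
    refine hlim.congr' ?_
    filter_upwards [hP] with d hd
    set c := PowerSeries.C (d : ℝ)⁻¹
    have hfall : c ^ j * fallingDerivative j (P d) = A d * P d := by
      simp only [A]
      linear_combination (-(c ^ j * fallingDerivative j (P d))) *
        PowerSeries.mul_inv_cancel _ hd
    have hderiv : c ^ j * fallingDerivative 1 (fallingDerivative j (P d))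
        = fallingDerivative 1 (A d * P d) := by
      rw [← hfall, fallingDerivative_one, fallingDerivative_one, Derivation.leibniz, ← map_pow,
        PowerSeries.derivative_C]
      simp only [smul_eq_mul]; ring
    rw [fallingDerivative_one_mul, fallingDerivative_one (A d)] at hderiv
    rw [fallingDerivative_succ j]
    linear_combination (-(c * (P d)⁻¹)) * hderiv + (j * c * (P d)⁻¹) * hfall
      - c * (PowerSeries.X * PowerSeries.derivative ℝ (A d) - j * A d) *
        PowerSeries.mul_inv_cancel _ hd

end Limits

/-! ### Reversed polynomials and power sums of roots -/

section Reverse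

variable {K : Type*}

/-- The reversed polynomial `x ^ d f(1/x)`, `d` the degree of `f`, as a power series. For monic
`f` with roots `λ_i` this is `∏ (1 - λ_i x)`. -/
noncomputable def reverseSeries [Semiring K] (f : K[X]) : K⟦X⟧ := (f.reverse : K[X])

lemma coeff_reverseSeries [Semiring K] (f : K[X]) (k : ℕ) :
    PowerSeries.coeff k (reverseSeries f) = if k ≤ f.natDegree then f.coeff (f.natDegree - k)
      else 0 := by
  rw [reverseSeries, Polynomial.coeff_coe, Polynomial.coeff_reverse]
  split_ifs with hk
  · rw [Polynomial.revAt_le hk]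
  · rw [Polynomial.revAt_eq_self_of_lt (not_le.1 hk),
      Polynomial.coeff_eq_zero_of_natDegree_lt (not_le.1 hk)]

lemma constantCoeff_reverseSeries [Semiring K] {f : K[X]} (hf : f.Monic) :
    PowerSeries.constantCoeff (reverseSeries f) = 1 := by
  rw [← PowerSeries.coeff_zero_eq_constantCoeff_apply, coeff_reverseSeries,
    if_pos (Nat.zero_le _), Nat.sub_zero, hf.coeff_natDegree]

lemma map_reverseSeries [Field K] {L : Type*} [Field L] (φ : K →+* L) (f : K[X]) :
    PowerSeries.map φ (reverseSeries f) = reverseSeries (f.map φ) := by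
  ext k
  simp only [PowerSeries.coeff_map, coeff_reverseSeries, Polynomial.natDegree_map,
    Polynomial.coeff_map, apply_ite φ, map_zero]

lemma reverseSeries_mul [CommRing K] [IsDomain K] (f g : K[X]) :
    reverseSeries (f * g) = reverseSeries f * reverseSeries g := by
  rw [reverseSeries, Polynomial.reverse_mul_of_domain, Polynomial.coe_mul, reverseSeries,
    reverseSeries]

lemma reverseSeries_X_sub_C [CommRing K] [Nontrivial K] (a : K) :
    reverseSeries (X - C a) = 1 - PowerSeries.C a * PowerSeries.X := by
  ext k
  rw [coeff_reverseSeries, natDegree_X_sub_C]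
  rcases k with _ | _ | k <;> simp [PowerSeries.coeff_one]

lemma derivative_reverseSeries_prod [CommRing K] [IsDomain K] (s : Multiset K) :
    PowerSeries.derivative K (reverseSeries (s.map fun z => X - C z).prod)
      = -(reverseSeries (s.map fun z => X - C z).prod *
        PowerSeries.mk fun n => (s.map fun z => z ^ (n + 1)).sum) := by
  induction s using Multiset.induction_on with
  | empty =>
    have hone : reverseSeries (1 : K[X]) = 1 := by
      ext k; simp [coeff_reverseSeries, PowerSeries.coeff_one]
    ext n; simp [hone]
  | cons a s ih =>
    have hgeom : (1 - PowerSeries.C a * PowerSeries.X) * PowerSeries.mk (fun n => a ^ (n + 1))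
        = PowerSeries.C a := by
      ext n
      rw [sub_mul, one_mul, mul_assoc]
      cases n <;> simp [PowerSeries.coeff_succ_X_mul, PowerSeries.coeff_C, pow_succ']
    have hadd : (PowerSeries.mk fun n => ((a ::ₘ s).map fun z => z ^ (n + 1)).sum)
        = PowerSeries.mk (fun n => a ^ (n + 1))
          + PowerSeries.mk fun n => (s.map fun z => z ^ (n + 1)).sum := by
      ext n; simp
    have hlin : PowerSeries.derivative K (1 - PowerSeries.C a * PowerSeries.X)
        = -PowerSeries.C a := by
      simp
    rw [Multiset.map_cons, Multiset.prod_cons, reverseSeries_mul, reverseSeries_X_sub_C, hadd,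
      Derivation.leibniz, ih, hlin, smul_eq_mul, smul_eq_mul]
    linear_combination reverseSeries (s.map fun z => X - C z).prod * hgeom

/-- The negative logarithmic derivative of the reversed polynomial. By Newton's identities its
coefficient of `x ^ n` is the power sum of the roots of exponent `n + 1`. -/
noncomputable def newtonSeries [Field K] (f : K[X]) : K⟦X⟧ :=
  -(PowerSeries.derivative K (reverseSeries f) * (reverseSeries f)⁻¹)

lemma derivative_reverseSeries [Field K] {f : K[X]} (hf : f.Monic) :
    PowerSeries.derivative K (reverseSeries f) = -(reverseSeries f * newtonSeries f) := by
  have h0 : PowerSeries.constantCoeff (reverseSeries f) ≠ 0 := by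
    rw [constantCoeff_reverseSeries hf]; exact one_ne_zero
  rw [newtonSeries]
  linear_combination (-PowerSeries.derivative K (reverseSeries f)) *
    PowerSeries.mul_inv_cancel _ h0

lemma map_newtonSeries {f : ℝ[X]} (hf : f.Monic) :
    PowerSeries.map (algebraMap ℝ ℂ) (newtonSeries f)
      = PowerSeries.mk fun n => ((f.map (algebraMap ℝ ℂ)).roots.map fun z => z ^ (n + 1)).sum := by
  set g := f.map (algebraMap ℝ ℂ) with hg
  have hgm : g.Monic := hf.map _
  have hprod : g = (g.roots.map fun z => X - C z).prod := by
    simpa [hgm.leadingCoeff] using (IsAlgClosed.splits g).eq_prod_roots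
  have hnewton := derivative_reverseSeries_prod g.roots
  rw [← hprod] at hnewton
  have hmap : PowerSeries.derivative ℂ (reverseSeries g)
      = -(reverseSeries g * PowerSeries.map (algebraMap ℝ ℂ) (newtonSeries f)) := by
    rw [hg, ← map_reverseSeries, ← map_mul, ← map_neg, ← derivative_reverseSeries hf]
    ext n; simp [PowerSeries.coeff_derivative]
  have hne : reverseSeries g ≠ 0 := fun h => by
    simpa [h] using constantCoeff_reverseSeries hgm
  exact mul_left_cancel₀ hne (neg_injective (hmap.symm.trans hnewton))

end Reverse

lemma coeff_newtonSeries {f : ℝ[X]} (hf : f.Monic) (n : ℕ) :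
    ((PowerSeries.coeff n (newtonSeries f) : ℝ) : ℂ)
      = ((f.map (algebraMap ℝ ℂ)).roots.map fun z => z ^ (n + 1)).sum := by
  simpa using congrArg (PowerSeries.coeff n) (map_newtonSeries hf)

lemma rootMoment_succ {f : ℝ[X]} (hf : f.Monic) (d n : ℕ) :
    rootMoment d f (n + 1) = ((PowerSeries.coeff n (newtonSeries f) / d : ℝ) : ℂ) := by
  rw [rootMoment, ← coeff_newtonSeries hf]
  norm_cast

lemma rootMoment_zero {d : ℕ} (hd : d ≠ 0) {f : ℝ[X]} (hf : f.natDegree = d) :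
    rootMoment d f 0 = 1 := by
  have hcard : Multiset.card (f.map (algebraMap ℝ ℂ)).roots = d := by
    rw [← (IsAlgClosed.splits _).natDegree_eq_card_roots, Polynomial.natDegree_map, hf]
  simp [rootMoment, hcard, hd]

lemma roots_taylor {K : Type*} [Field K] (f : K[X]) (r : K) :
    (taylor r f).roots = f.roots.map fun z => z - r := by
  simpa [taylor_apply, Ring.inverse_one] using f.roots_comp_C_mul_X_add_C 1 r isUnit_one

/-! ### Finite free multiplicative convolution -/

section FiniteFreeMulConv

lemma coeff_finiteFreeMulConv {d k : ℕ} (hk : k ≤ d) (p q : ℝ[X]) :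
    (finiteFreeMulConv d p q).coeff (d - k)
      = (-1) ^ k * (d.choose k : ℝ) * (normCoeff d p k * normCoeff d q k) := by
  rw [finiteFreeMulConv, Polynomial.finsetSum_coeff, Finset.sum_eq_single k]
  · rw [Polynomial.coeff_C_mul, Polynomial.coeff_X_pow_self, mul_one]
  · intro j hj hjk
    have hjd : j ≤ d := Nat.lt_succ_iff.1 (mem_range.1 hj)
    rw [Polynomial.coeff_C_mul, Polynomial.coeff_X_pow, if_neg (by omega), mul_zero]
  · exact fun h => absurd (mem_range.2 (Nat.lt_succ_of_le hk)) h

lemma coeff_finiteFreeMulConv_eq_coeff_mul {d k : ℕ} (hk : k ≤ d) (p q : ℝ[X]) :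
    (finiteFreeMulConv d p q).coeff (d - k) = p.coeff (d - k) * normCoeff d q k := by
  have hchoose : (d.choose k : ℝ) ≠ 0 := by exact_mod_cast (Nat.choose_pos hk).ne'
  have hsign : (-1 : ℝ) ^ k * (-1) ^ k = 1 := by rw [← mul_pow]; simp
  rw [coeff_finiteFreeMulConv hk, normCoeff.eq_def d p]
  field_simp
  linear_combination p.coeff (d - k) * normCoeff d q k * hsign

lemma normCoeff_zero {d : ℕ} {p : ℝ[X]} (hp : p.IsMonicOfDegree d) : normCoeff d p 0 = 1 := by
  simp [normCoeff, ← hp.natDegree_eq, hp.monic.leadingCoeff]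

lemma isMonicOfDegree_finiteFreeMulConv {d : ℕ} {p q : ℝ[X]} (hp : p.IsMonicOfDegree d)
    (hq : q.IsMonicOfDegree d) : (finiteFreeMulConv d p q).IsMonicOfDegree d := by
  refine (isMonicOfDegree_iff _ _).2 ⟨?_, ?_⟩
  · exact Polynomial.natDegree_sum_le_of_forall_le _ _ fun k _ =>
      (Polynomial.natDegree_C_mul_X_pow_le _ _).trans (Nat.sub_le _ _)
  · simpa [normCoeff_zero hp, normCoeff_zero hq] using coeff_finiteFreeMulConv (Nat.zero_le d) p q

lemma choose_mul_descFactorial {d k j : ℕ} (hjk : j ≤ k) (hkd : k ≤ d) :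
    (d - j).choose (d - k) * d.descFactorial j = d.choose k * k.descFactorial j := by
  rw [Nat.descFactorial_eq_factorial_mul_choose, Nat.descFactorial_eq_factorial_mul_choose,
    Nat.choose_symm_of_eq_add (show d - j = d - k + (k - j) by omega)]
  calc _ = j.factorial * (d.choose j * (d - j).choose (k - j)) := by ring
    _ = _ := by rw [← Nat.choose_mul hjk]; ring

lemma coeff_eq_sum_coeff_taylor (q : ℝ[X]) (i : ℕ) :
    q.coeff i = ∑ m ∈ range (q.natDegree + 1),
      (m.choose i : ℝ) * (taylor 1 q).coeff m * (-1) ^ (m - i) := by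
  conv_lhs => rw [← taylor_zero q, ← neg_add_cancel (1 : ℝ), ← taylor_taylor]
  rw [taylor_coeff, hasseDeriv_apply, Polynomial.sum_over_range' _ (by simp) (q.natDegree + 1)
    (by rw [natDegree_taylor]; exact Nat.lt_succ_self _), Polynomial.eval_finsetSum]
  simp

lemma normCoeff_eq_sum_descFactorial {d k : ℕ} {q : ℝ[X]} (hq : q.natDegree = d) (hk : k ≤ d) :
    normCoeff d q k = ∑ j ∈ range (d + 1), (-1) ^ j *
      PowerSeries.coeff j (reverseSeries (taylor 1 q)) *
        (k.descFactorial j / d.descFactorial j) := by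
  rw [normCoeff, coeff_eq_sum_coeff_taylor, hq, ← Finset.sum_range_reflect, Finset.mul_sum,
    Finset.sum_div]
  refine Finset.sum_congr rfl fun j hj => ?_
  have hjd : j ≤ d := Nat.lt_succ_iff.1 (mem_range.1 hj)
  rw [coeff_reverseSeries, natDegree_taylor, hq, if_pos hjd, show d + 1 - 1 - j = d - j by omega]
  rcases Nat.lt_or_ge k j with hkj | hjk
  · rw [Nat.descFactorial_eq_zero_iff_lt.2 hkj, Nat.choose_eq_zero_of_lt (by omega)]; simp
  have hratio : ((d - j).choose (d - k) : ℝ) / d.choose k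
      = k.descFactorial j / d.descFactorial j := by
    rw [div_eq_div_iff (by exact_mod_cast (Nat.choose_pos hk).ne')
      (by exact_mod_cast (Nat.descFactorial_eq_zero_iff_lt.not.2 (not_lt.2 hjd)))]
    exact_mod_cast (choose_mul_descFactorial hjk hk).trans (mul_comm _ _)
  have hsign : (-1 : ℝ) ^ k * (-1) ^ (d - j - (d - k)) = (-1) ^ j := by
    rw [← pow_add, show k + (d - j - (d - k)) = j + 2 * (k - j) by omega, pow_add, pow_mul]
    simp
  rw [← hsign, ← hratio]
  ring

lemma reverseSeries_finiteFreeMulConv {d : ℕ} {p q : ℝ[X]} (hp : p.IsMonicOfDegree d)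
    (hq : q.IsMonicOfDegree d) :
    reverseSeries (finiteFreeMulConv d p q) = ∑ j ∈ range (d + 1),
      PowerSeries.C ((-1) ^ j * PowerSeries.coeff j (reverseSeries (taylor 1 q))
        / d.descFactorial j) * fallingDerivative j (reverseSeries p) := by
  ext k
  simp only [map_sum, PowerSeries.coeff_C_mul, coeff_fallingDerivative]
  rw [coeff_reverseSeries, (isMonicOfDegree_finiteFreeMulConv hp hq).natDegree_eq]
  simp only [coeff_reverseSeries p, hp.natDegree_eq]
  split_ifs with hk
  · rw [coeff_finiteFreeMulConv_eq_coeff_mul hk, normCoeff_eq_sum_descFactorial hq.natDegree_eq hk,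
      Finset.mul_sum]
    exact Finset.sum_congr rfl fun j _ => by ring
  · simp

lemma tendsto_pow_div_descFactorial (j : ℕ) :
    Tendsto (fun d : ℕ => (d : ℝ) ^ j / d.descFactorial j) atTop (𝓝 1) := by
  refine (Asymptotics.isEquivalent_iff_tendsto_one ?_).1 (isEquivalent_descFactorial j).symm
  filter_upwards [eventually_ge_atTop j] with d hd
  exact_mod_cast Nat.descFactorial_eq_zero_iff_lt.not.2 (not_lt.2 hd)

lemma coeff_reverseSeries_finiteFreeMulConv_mul_inv {d n : ℕ} {p q : ℝ[X]}
    (hp : p.IsMonicOfDegree d) (hq : q.IsMonicOfDegree d) (hn : n < d) :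
    PowerSeries.coeff n (reverseSeries (finiteFreeMulConv d p q) * (reverseSeries p)⁻¹)
      = ∑ j ∈ range (n + 1), (-1) ^ j * PowerSeries.coeff j (reverseSeries (taylor 1 q)) *
        ((d : ℝ) ^ j / d.descFactorial j) * PowerSeries.coeff n (PowerSeries.C (d : ℝ)⁻¹ ^ j *
          (fallingDerivative j (reverseSeries p) * (reverseSeries p)⁻¹)) := by
  have hd : (d : ℝ) ≠ 0 := by exact_mod_cast (Nat.zero_lt_of_lt hn).ne'
  rw [reverseSeries_finiteFreeMulConv hp hq, Finset.sum_mul, map_sum]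
  symm
  refine (Finset.sum_congr rfl fun j _ => ?_).trans
    (Finset.sum_subset (range_subset_range.2 (by omega)) fun j _ hj => ?_)
  · rw [mul_assoc (PowerSeries.C _), PowerSeries.coeff_C_mul, ← map_pow, PowerSeries.coeff_C_mul,
      inv_pow]
    field_simp
  · rw [mul_assoc, PowerSeries.coeff_C_mul,
      coeff_fallingDerivative_mul_of_lt (by simpa using hj), mul_zero]

lemma tendsto_reverseSeries_finiteFreeMulConv_mul_inv {p q : ℕ → ℝ[X]} {a M : ℝ⟦X⟧}
    (hp : ∀ d, 1 ≤ d → (p d).IsMonicOfDegree d) (hq : ∀ d, 1 ≤ d → (q d).IsMonicOfDegree d)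
    (hM : Tendsto (fun d : ℕ => PowerSeries.C (d : ℝ)⁻¹ *
      (PowerSeries.X * newtonSeries (p d))) atTop (𝓝 M))
    (hM0 : PowerSeries.constantCoeff M = 0)
    (ha : Tendsto (fun d => reverseSeries (taylor 1 (q d))) atTop (𝓝 a)) :
    Tendsto (fun d => reverseSeries (finiteFreeMulConv d (p d) (q d)) * (reverseSeries (p d))⁻¹)
      atTop (𝓝 (a.subst M)) := by
  have hP : ∀ᶠ d in atTop, PowerSeries.constantCoeff (reverseSeries (p d)) ≠ 0 := by
    filter_upwards [eventually_ge_atTop 1] with d hd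
    rw [constantCoeff_reverseSeries (hp d hd).monic]; exact one_ne_zero
  have hfall := tendsto_fallingDerivative_mul_inv (u := -M) hP (hM.neg.congr fun d => by
    rw [fallingDerivative_one, newtonSeries]; ring)
  rw [PowerSeries.WithPiTopology.tendsto_iff_coeff_tendsto] at ha ⊢
  intro n
  have hterm : ∀ j ∈ range (n + 1), Tendsto (fun d : ℕ => (-1) ^ j *
      PowerSeries.coeff j (reverseSeries (taylor 1 (q d))) * ((d : ℝ) ^ j / d.descFactorial j) *
      PowerSeries.coeff n (PowerSeries.C (d : ℝ)⁻¹ ^ j *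
        (fallingDerivative j (reverseSeries (p d)) * (reverseSeries (p d))⁻¹))) atTop
      (𝓝 ((-1) ^ j * PowerSeries.coeff j a * 1 * PowerSeries.coeff n ((-M) ^ j))) := fun j _ =>
    (((ha j).const_mul _).mul (tendsto_pow_div_descFactorial j)).mul
      ((PowerSeries.WithPiTopology.tendsto_iff_coeff_tendsto _ _ _ _).1 (hfall j) n)
  have hsubst : PowerSeries.coeff n (a.subst M) = ∑ j ∈ range (n + 1),
      (-1) ^ j * PowerSeries.coeff j a * 1 * PowerSeries.coeff n ((-M) ^ j) := by
    rw [coeff_subst_eq_sum hM0]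
    refine Finset.sum_congr rfl fun j _ => ?_
    rcases Nat.even_or_odd j with hj | hj <;> simp [hj.neg_pow]
  rw [hsubst]
  refine (tendsto_finsetSum _ hterm).congr' ?_
  filter_upwards [eventually_ge_atTop (n + 1)] with d hd
  exact (coeff_reverseSeries_finiteFreeMulConv_mul_inv (hp d (by omega)) (hq d (by omega)) hd).symm

lemma newtonSeries_sub_newtonSeries {f g : ℝ[X]} (hf : f.Monic) (hg : g.Monic) :
    newtonSeries f - newtonSeries g
      = -(PowerSeries.derivative ℝ (reverseSeries f * (reverseSeries g)⁻¹) *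
        (reverseSeries f * (reverseSeries g)⁻¹)⁻¹) := by
  have hf0 : PowerSeries.constantCoeff (reverseSeries f) ≠ 0 := by
    rw [constantCoeff_reverseSeries hf]; exact one_ne_zero
  have hquot : PowerSeries.constantCoeff (reverseSeries f * (reverseSeries g)⁻¹) ≠ 0 := by
    simp [constantCoeff_reverseSeries hf, constantCoeff_reverseSeries hg]
  rw [newtonSeries, newtonSeries, Derivation.leibniz, PowerSeries.derivative_inv', smul_eq_mul,
    smul_eq_mul]
  linear_combination (PowerSeries.derivative ℝ (reverseSeries f) * (reverseSeries f)⁻¹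
      - PowerSeries.derivative ℝ (reverseSeries g) * (reverseSeries g)⁻¹) *
        PowerSeries.mul_inv_cancel _ hquot
    - PowerSeries.derivative ℝ (reverseSeries f) * (reverseSeries g)⁻¹ *
        (reverseSeries f * (reverseSeries g)⁻¹)⁻¹ * PowerSeries.mul_inv_cancel _ hf0

lemma tendsto_newtonSeries_sub_newtonSeries {ι : Type*} {l : Filter ι} {f g : ι → ℝ[X]} {b : ℝ⟦X⟧}
    (hf : ∀ᶠ i in l, (f i).Monic) (hg : ∀ᶠ i in l, (g i).Monic)
    (hb : Tendsto (fun i => reverseSeries (f i) * (reverseSeries (g i))⁻¹) l (𝓝 b))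
    (hb0 : PowerSeries.constantCoeff b ≠ 0) :
    Tendsto (fun i => newtonSeries (f i) - newtonSeries (g i)) l
      (𝓝 (-(PowerSeries.derivative ℝ b * b⁻¹))) := by
  refine ((tendsto_powerSeries_derivative hb).mul (tendsto_powerSeries_inv hb hb0)).neg.congr' ?_
  filter_upwards [hf, hg] with i hfi hgi
  exact (newtonSeries_sub_newtonSeries hfi hgi).symm

lemma exists_tendsto_reverseSeries {ι : Type*} {l : Filter ι} [l.NeBot] {f : ι → ℝ[X]} {κ : ℝ⟦X⟧}
    (hf : ∀ᶠ i in l, (f i).Monic) (hκ : Tendsto (fun i => newtonSeries (f i)) l (𝓝 κ)) :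
    ∃ a, Tendsto (fun i => reverseSeries (f i)) l (𝓝 a) ∧ PowerSeries.constantCoeff a = 1 ∧
      PowerSeries.derivative ℝ a = -(a * κ) := by
  have hconst := hf.mono fun i => constantCoeff_reverseSeries
  have hderiv := hf.mono fun i => derivative_reverseSeries
  obtain ⟨a, ha⟩ := exists_tendsto_of_derivative_eq hconst hderiv hκ
  refine ⟨a, ha, ?_, ?_⟩
  · exact tendsto_nhds_unique
      (((PowerSeries.WithPiTopology.continuous_constantCoeff ℝ).tendsto a).comp ha)
      (tendsto_const_nhds.congr' (hconst.mono fun i hi => hi.symm))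
  · exact tendsto_nhds_unique (tendsto_powerSeries_derivative ha)
      ((ha.mul hκ).neg.congr' (hderiv.mono fun i hi => hi.symm))

lemma tendsto_newtonSeries_finiteFreeMulConv_sub {p q : ℕ → ℝ[X]} {κ M : ℝ⟦X⟧}
    (hp : ∀ d, 1 ≤ d → (p d).IsMonicOfDegree d) (hq : ∀ d, 1 ≤ d → (q d).IsMonicOfDegree d)
    (hM : Tendsto (fun d : ℕ => PowerSeries.C (d : ℝ)⁻¹ *
      (PowerSeries.X * newtonSeries (p d))) atTop (𝓝 M))
    (hM0 : PowerSeries.constantCoeff M = 0)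
    (hκ : Tendsto (fun d => newtonSeries (taylor 1 (q d))) atTop (𝓝 κ)) :
    Tendsto (fun d => newtonSeries (finiteFreeMulConv d (p d) (q d)) - newtonSeries (p d)) atTop
      (𝓝 (κ.subst M * PowerSeries.derivative ℝ M)) := by
  have hp1 : ∀ᶠ d in atTop, (p d).Monic := (eventually_ge_atTop 1).mono fun d hd => (hp d hd).monic
  have hq1 : ∀ᶠ d in atTop, (taylor 1 (q d)).Monic :=
    (eventually_ge_atTop 1).mono fun d hd => (leadingCoeff_taylor _ _).trans (hq d hd).monic
  have hpq1 : ∀ᶠ d in atTop, (finiteFreeMulConv d (p d) (q d)).Monic :=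
    (eventually_ge_atTop 1).mono fun d hd =>
      (isMonicOfDegree_finiteFreeMulConv (hp d hd) (hq d hd)).monic
  obtain ⟨a, ha, ha0, haκ⟩ := exists_tendsto_reverseSeries hq1 hκ
  have hM' := PowerSeries.HasSubst.of_constantCoeff_zero' hM0
  have haM0 : PowerSeries.constantCoeff (a.subst M) ≠ 0 := by
    rw [← PowerSeries.coeff_zero_eq_constantCoeff_apply, coeff_subst_eq_sum hM0]
    simp [ha0]
  have hvalue : -(PowerSeries.derivative ℝ (a.subst M) * (a.subst M)⁻¹)
      = κ.subst M * PowerSeries.derivative ℝ M := by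
    rw [PowerSeries.derivative_subst hM', haκ, ← PowerSeries.coe_substAlgHom hM', map_neg, map_mul,
      PowerSeries.coe_substAlgHom]
    linear_combination (κ.subst M * PowerSeries.derivative ℝ M) *
      PowerSeries.mul_inv_cancel _ haM0
  rw [← hvalue]
  exact tendsto_newtonSeries_sub_newtonSeries hpq1 hp1
    (tendsto_reverseSeries_finiteFreeMulConv_mul_inv hp hq hM hM0 ha) haM0

end FiniteFreeMulConv

/-! ### Infinitesimal distributions in terms of Newton series -/

section NewtonSeries

variable {p : ℕ → ℝ[X]} {μ : Measure ℝ} {μ' : ℝ[X] →ₗ[ℝ] ℝ}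

lemma IsInfDistribution.integrable_eval (h : IsInfDistribution μ μ') (f : ℝ[X]) :
    Integrable (fun t => f.eval t) μ := by
  simp only [Polynomial.eval_eq_sum_range]
  exact integrable_finsetSum _ fun i _ => (h.integrable_pow i).const_mul _

lemma HasInfDistribution.tendsto_sum_roots_sub (h : HasInfDistribution p μ μ') (f : ℝ[X]) :
    Tendsto (fun d : ℕ => (((p d).map (algebraMap ℝ ℂ)).roots.map fun z => aeval z f).sum
      - d * ((∫ t, f.eval t ∂μ : ℝ) : ℂ)) atTop (𝓝 ((μ' f : ℝ) : ℂ)) := by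
  induction f using Polynomial.induction_on' with
  | add f g hf hg =>
    simp only [map_add, Complex.ofReal_add, Polynomial.eval_add, Multiset.sum_map_add]
    rw [integral_add (h.isInfDistribution.integrable_eval f)
      (h.isInfDistribution.integrable_eval g)]
    exact (hf.add hg).congr fun d => by push_cast; ring
  | monomial n a =>
    have hlim := (h.tendsto_infMoment n).const_mul (a : ℂ)
    have hμ' : ((μ' (monomial n a) : ℝ) : ℂ) = a * functionalMoment μ' n := by
      rw [functionalMoment, ← C_mul_X_pow_eq_monomial, ← smul_eq_C_mul, map_smul, smul_eq_mul,
        Complex.ofReal_mul]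
    rw [hμ']
    refine hlim.congr' ?_
    filter_upwards [eventually_ne_atTop 0] with d hd
    have hd' : (d : ℂ) ≠ 0 := by exact_mod_cast hd
    simp only [aeval_monomial, Polynomial.eval_monomial, Multiset.sum_map_mul_left,
      integral_const_mul, rootMoment, measureMoment, Complex.coe_algebraMap]
    push_cast
    field_simp

lemma HasInfDistribution.tendsto_newtonSeries (hp : ∀ d, 1 ≤ d → (p d).IsMonicOfDegree d)
    (h : HasInfDistribution p μ μ') :
    Tendsto (fun d : ℕ => PowerSeries.C (d : ℝ)⁻¹ * (PowerSeries.X * newtonSeries (p d))) atTop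
      (𝓝 (momentSeries (measureMoment μ))) := by
  suffices hlim : Tendsto (fun d : ℕ => PowerSeries.C (d : ℝ)⁻¹ * newtonSeries (p d)) atTop
      (𝓝 (PowerSeries.mk fun n => measureMoment μ (n + 1))) from
    (hlim.const_mul PowerSeries.X).congr fun d => mul_left_comm _ _ _
  rw [PowerSeries.WithPiTopology.tendsto_iff_coeff_tendsto]
  intro n
  rw [← Filter.tendsto_ofReal_iff, PowerSeries.coeff_mk]
  refine (h.tendsto_moment (n + 1)).congr' ((eventually_ge_atTop 1).mono fun d hd => ?_)
  dsimp only
  rw [rootMoment_succ (hp d hd).monic, PowerSeries.coeff_C_mul, div_eq_inv_mul]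

lemma HasInfDistribution.tendsto_newtonSeries_taylor {q : ℕ → ℝ[X]} {ν' : ℝ[X] →ₗ[ℝ] ℝ}
    (hq : ∀ d, 1 ≤ d → (q d).IsMonicOfDegree d)
    (h : HasInfDistribution q (Measure.dirac 1) ν') :
    Tendsto (fun d => newtonSeries (taylor 1 (q d))) atTop
      (𝓝 (PowerSeries.mk fun n => ν' ((X - 1) ^ (n + 1)))) := by
  rw [PowerSeries.WithPiTopology.tendsto_iff_coeff_tendsto]
  intro n
  rw [← Filter.tendsto_ofReal_iff, PowerSeries.coeff_mk]
  refine (h.tendsto_sum_roots_sub ((X - 1) ^ (n + 1))).congr'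
    ((eventually_ge_atTop 1).mono fun d hd => ?_)
  have hmonic : (taylor 1 (q d)).Monic := (leadingCoeff_taylor _ _).trans (hq d hd).monic
  have hmap : (taylor 1 (q d)).map (algebraMap ℝ ℂ) = taylor 1 ((q d).map (algebraMap ℝ ℂ)) := by
    simp [taylor_apply, Polynomial.map_comp]
  dsimp only
  rw [coeff_newtonSeries hmonic, hmap, roots_taylor, Multiset.map_map]
  simp

lemma HasInfDistribution.of_tendsto_infMoment (h : IsInfDistribution μ μ')
    (hinf : ∀ n, Tendsto (fun d : ℕ => (d : ℂ) * (rootMoment d (p d) n - (measureMoment μ n : ℂ)))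
      atTop (𝓝 (functionalMoment μ' n : ℂ))) :
    HasInfDistribution p μ μ' := by
  refine ⟨h, fun n => ?_, hinf⟩
  have hinv : Tendsto (fun d : ℕ => ((d : ℂ))⁻¹) atTop (𝓝 0) := tendsto_inv_atTop_nhds_zero_nat
  have hlim := (hinv.mul (hinf n)).add_const (measureMoment μ n : ℂ)
  rw [zero_mul, zero_add] at hlim
  refine hlim.congr' ((eventually_ne_atTop 0).mono fun d hd => ?_)
  have hd' : (d : ℂ) ≠ 0 := by exact_mod_cast hd
  field_simp
  ring

lemma HasInfDistribution.of_tendsto_newtonSeries_sub {f : ℕ → ℝ[X]} {γ : Measure ℝ}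
    {γ' : ℝ[X] →ₗ[ℝ] ℝ} {D : ℝ⟦X⟧} (hp : ∀ d, 1 ≤ d → (p d).IsMonicOfDegree d)
    (hf : ∀ d, 1 ≤ d → (f d).IsMonicOfDegree d) (h : HasInfDistribution p μ μ')
    (hD : Tendsto (fun d => newtonSeries (f d) - newtonSeries (p d)) atTop (𝓝 D))
    (hγ : IsInfDistribution γ γ') (hmoment : measureMoment γ = measureMoment μ)
    (hinf : ∀ n, functionalMoment γ' (n + 1)
      = functionalMoment μ' (n + 1) + PowerSeries.coeff n D) :
    HasInfDistribution f γ γ' := by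
  refine .of_tendsto_infMoment hγ fun n => ?_
  rw [hmoment]
  cases n with
  | zero =>
    have hzero : ∀ {σ : Measure ℝ} {σ' : ℝ[X] →ₗ[ℝ] ℝ}, IsInfDistribution σ σ' →
        functionalMoment σ' 0 = 0 := fun hσ => by rw [functionalMoment, pow_zero, hσ.map_one]
    rw [hzero hγ, ← hzero h.isInfDistribution]
    refine (h.tendsto_infMoment 0).congr' ((eventually_ge_atTop 1).mono fun d hd => ?_)
    dsimp only
    rw [rootMoment_zero (by omega) (hp d hd).natDegree_eq,
      rootMoment_zero (by omega) (hf d hd).natDegree_eq]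
  | succ n =>
    have hcoeff := (Complex.continuous_ofReal.tendsto _).comp
      ((PowerSeries.WithPiTopology.tendsto_iff_coeff_tendsto _ _ _ _).1 hD n)
    rw [hinf, Complex.ofReal_add]
    refine ((h.tendsto_infMoment (n + 1)).add hcoeff).congr'
      ((eventually_ge_atTop 1).mono fun d hd => ?_)
    have hd' : (d : ℂ) ≠ 0 := by exact_mod_cast (by omega : d ≠ 0)
    dsimp only [Function.comp_apply]
    rw [rootMoment_succ (hp d hd).monic, rootMoment_succ (hf d hd).monic, map_sub]
    push_cast
    field_simp
    ring

end NewtonSeries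

/-! ### Set partitions -/

section SetPartition

variable {n : ℕ} {σ π : SetPartition n}

lemma mem_part_iff {i j : Fin n} : i ∈ π.part j ↔ π.part i = π.part j :=
  π.mem_part_iff_part_eq_part (mem_univ i) (mem_univ j)

lemma part_mem_parts (π : SetPartition n) (i : Fin n) : π.part i ∈ π.parts :=
  π.part_mem.2 (mem_univ i)

lemma self_mem_part (π : SetPartition n) (i : Fin n) : i ∈ π.part i :=
  π.mem_part (mem_univ i)

lemma parts_eq_image_part (π : SetPartition n) : π.parts = univ.image π.part := by
  ext V
  simp only [mem_image, mem_univ, true_and]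
  constructor
  · intro hV
    obtain ⟨i, hi⟩ := π.nonempty_of_mem_parts hV
    exact ⟨i, π.part_eq_of_mem hV hi⟩
  · rintro ⟨i, rfl⟩
    exact part_mem_parts π i

lemma le_iff_part : σ ≤ π ↔ ∀ i j, σ.part i = σ.part j → π.part i = π.part j := by
  constructor
  · intro h i j hij
    obtain ⟨V, hV, hsub⟩ := h (part_mem_parts σ j)
    rw [π.part_eq_of_mem hV (hsub (mem_part_iff.2 hij)),
      π.part_eq_of_mem hV (hsub (self_mem_part σ j))]
  · intro h V hV
    obtain ⟨j, hj⟩ := σ.nonempty_of_mem_parts hV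
    refine ⟨π.part j, part_mem_parts π j, fun i hi => mem_part_iff.2 (h i j ?_)⟩
    rw [σ.part_eq_of_mem hV hi, σ.part_eq_of_mem hV hj]

lemma setPartition_ext (h : ∀ i j, σ.part i = σ.part j ↔ π.part i = π.part j) : σ = π :=
  le_antisymm (le_iff_part.2 fun i j => (h i j).1) (le_iff_part.2 fun i j => (h i j).2)

lemma part_top (i : Fin n) : (⊤ : SetPartition n).part i = univ := by
  rw [Finpartition.part_eq_iff_mem _ ?_]
  · exact mem_univ i
  · rw [parts_top i.pos.ne', mem_singleton]

lemma part_ofSetoid_eq_iff (s : Setoid (Fin n)) [DecidableRel s.r] {i j : Fin n} :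
    (Finpartition.ofSetoid s).part i = (Finpartition.ofSetoid s).part j ↔ s i j := by
  rw [← mem_part_iff, Finpartition.mem_part_ofSetoid_iff_rel]
  exact ⟨fun h => s.symm h, fun h => s.symm h⟩

lemma isNoncrossing_iff_part : IsNoncrossing π ↔
    ∀ a b c d : Fin n, a < b → b < c → c < d → π.part a = π.part c → π.part b = π.part d →
      π.part a = π.part b := by
  constructor
  · intro h a b c d hab hbc hcd hac hbd
    exact h a b c d hab hbc hcd _ (part_mem_parts π a) _ (part_mem_parts π b) (self_mem_part π a)
      (mem_part_iff.2 hac.symm) (self_mem_part π b) (mem_part_iff.2 hbd.symm)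
  · intro h a b c d hab hbc hcd V hV W hW ha hc hb hd
    rw [← π.part_eq_of_mem hV ha, ← π.part_eq_of_mem hW hb]
    exact h a b c d hab hbc hcd
      ((π.part_eq_of_mem hV ha).trans (π.part_eq_of_mem hV hc).symm)
      ((π.part_eq_of_mem hW hb).trans (π.part_eq_of_mem hW hd).symm)

lemma mem_NC : π ∈ NC n ↔ IsNoncrossing π := by simp only [NC, mem_filter, mem_univ, true_and]

end SetPartition

/-! ### Runs -/

section Runs

variable {α : Type*} [LinearOrder α]

/-- The cyclic runs `(w, w']` cut out by a finite set `W`, where `w` and `w'` are cyclically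
consecutive in `W`; the run that contains `min W` also contains everything above `max W`. Two
elements lie in the same run iff no interval `(w, w']` with endpoints in `W` separates them. -/
def SameRun (W : Finset α) (i j : α) : Prop :=
  ∀ w ∈ W, ∀ w' ∈ W, i ∈ Set.Ioc w w' ↔ j ∈ Set.Ioc w w'

instance (W : Finset α) : DecidableRel (SameRun W) :=
  fun _ _ => inferInstanceAs (Decidable (∀ w ∈ W, ∀ w' ∈ W, (_ ∧ _) ↔ (_ ∧ _)))

variable {W : Finset α} {i j k w w' : α}

lemma SameRun.refl (i : α) : SameRun W i i := fun _ _ _ _ => Iff.rfl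

lemma SameRun.symm (h : SameRun W i j) : SameRun W j i := fun w hw w' hw' => (h w hw w' hw').symm

lemma SameRun.trans (h : SameRun W i j) (h' : SameRun W j k) : SameRun W i k :=
  fun w hw w' hw' => (h w hw w' hw').trans (h' w hw w' hw')

lemma SameRun.mono {U : Finset α} (hWU : W ⊆ U) (h : SameRun U i j) : SameRun W i j :=
  fun w hw w' hw' => h w (hWU hw) w' (hWU hw')

lemma SameRun.eq_of_mem (hw : w ∈ W) (hw' : w' ∈ W) (h : SameRun W w w') : w = w' := by
  wlog hlt : w < w' generalizing w w'
  · by_contra hne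
    exact hne (this hw' hw h.symm (lt_of_le_of_ne (not_lt.1 hlt) (Ne.symm hne))).symm
  exact absurd ((h w hw w' hw').2 ⟨hlt, le_rfl⟩).1 (lt_irrefl w)

lemma exists_sameRun (hW : W.Nonempty) (i : α) : ∃ w ∈ W, SameRun W i w := by
  by_cases hi : (W.filter (i ≤ ·)).Nonempty
  · refine ⟨(W.filter (i ≤ ·)).min' hi, (mem_filter.1 (min'_mem _ hi)).1, fun u hu v hv => ?_⟩
    set w := (W.filter (i ≤ ·)).min' hi
    have hiw : i ≤ w := (mem_filter.1 (min'_mem _ hi)).2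
    have hmin : ∀ x ∈ W, i ≤ x → w ≤ x := fun x hx hix => min'_le _ _ (mem_filter.2 ⟨hx, hix⟩)
    exact ⟨fun h => ⟨h.1.trans_le hiw, hmin v hv h.2⟩,
      fun h => ⟨not_le.1 fun hiu => (hmin u hu hiu).not_gt h.1, hiw.trans h.2⟩⟩
  · have hlt : ∀ x ∈ W, x < i := fun x hx => not_le.1 fun hix => hi ⟨x, mem_filter.2 ⟨hx, hix⟩⟩
    exact ⟨W.min' hW, min'_mem _ hW, fun u hu v hv =>
      ⟨fun h => absurd (hlt v hv) h.2.not_gt, fun h => absurd (min'_le W u hu) h.1.not_ge⟩⟩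

lemma sameRun_singleton (w i j : α) : SameRun {w} i j := by
  intro u hu v hv
  rw [mem_singleton.1 hu, mem_singleton.1 hv, Set.Ioc_self]
  rfl

/-- The partition of `[n]` into the runs of `W`. -/
def runPartition {n : ℕ} (W : Finset (Fin n)) : SetPartition n :=
  letI s : Setoid (Fin n) := ⟨SameRun W, SameRun.refl, SameRun.symm, SameRun.trans⟩
  letI : DecidableRel s.r := inferInstanceAs (DecidableRel (SameRun W))
  Finpartition.ofSetoid s

lemma part_runPartition_eq_iff {n : ℕ} {W : Finset (Fin n)} {i j : Fin n} :
    (runPartition W).part i = (runPartition W).part j ↔ SameRun W i j :=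
  letI s : Setoid (Fin n) := ⟨SameRun W, SameRun.refl, SameRun.symm, SameRun.trans⟩
  letI : DecidableRel s.r := inferInstanceAs (DecidableRel (SameRun W))
  part_ofSetoid_eq_iff s

lemma isNoncrossing_runPartition {n : ℕ} (W : Finset (Fin n)) : IsNoncrossing (runPartition W) := by
  rw [isNoncrossing_iff_part]
  intro a b c d hab hbc hcd hac hbd
  rw [part_runPartition_eq_iff] at *
  intro w hw w' hw'
  have h₁ := hac w hw w' hw'
  have h₂ := hbd w hw w' hw'
  simp only [Set.mem_Ioc, Fin.lt_def, Fin.le_def] at *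
  omega

lemma runPartition_singleton {n : ℕ} (w : Fin n) : runPartition {w} = ⊤ :=
  setPartition_ext fun i j => by
    rw [part_runPartition_eq_iff, part_top, part_top]
    exact iff_of_true (sameRun_singleton w i j) rfl

lemma prod_parts_runPartition {M : Type*} [CommMonoid M] {n : ℕ} {W : Finset (Fin n)}
    (hW : W.Nonempty) (f : Finset (Fin n) → M) :
    ∏ V ∈ (runPartition W).parts, f V = ∏ w ∈ W, f ((runPartition W).part w) := by
  have hparts : (runPartition W).parts = W.image (runPartition W).part := by
    rw [parts_eq_image_part]
    refine Subset.antisymm (fun V hV => ?_) (image_subset_image (subset_univ W))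
    obtain ⟨i, -, rfl⟩ := mem_image.1 hV
    obtain ⟨w, hw, hiw⟩ := exists_sameRun hW i
    exact mem_image.2 ⟨w, hw, (part_runPartition_eq_iff.2 hiw).symm⟩
  rw [hparts, prod_image fun w hw w' hw' h =>
    SameRun.eq_of_mem hw hw' (part_runPartition_eq_iff.1 h)]

end Runs

/-! ### The Kreweras complement -/

lemma formPerm_sort_apply {α : Type*} [LinearOrder α] {s : Finset α} {i : α} (hi : i ∈ s) :
    (i < (s.sort (· ≤ ·)).formPerm i ∧ ∀ x ∈ s, x ≤ i ∨ (s.sort (· ≤ ·)).formPerm i ≤ x) ∨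
      ∀ x ∈ s, x ≤ i ∧ (s.sort (· ≤ ·)).formPerm i ≤ x := by
  set l := s.sort (· ≤ ·)
  have hmem : ∀ x ∈ s, ∃ m, ∃ h : m < l.length, l[m] = x := fun x hx =>
    List.mem_iff_getElem.1 ((mem_sort _).2 hx)
  have hmono {j k : ℕ} (hj : j < l.length) (hk : k < l.length) : l[j] ≤ l[k] ↔ j ≤ k :=
    (sortedLT_sort s).getElem_le_getElem_iff
  obtain ⟨k, hk, rfl⟩ := hmem i hi
  rw [List.formPerm_apply_getElem l (sort_nodup _ _) k hk]
  rcases Nat.lt_or_ge (k + 1) l.length with hlt | hge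
  · simp only [Nat.mod_eq_of_lt hlt]
    refine .inl ⟨not_le.1 fun h => by simpa using (hmono _ _).1 h, fun x hx => ?_⟩
    obtain ⟨m, hm, rfl⟩ := hmem x hx
    rw [hmono, hmono]
    omega
  · have hmod : (k + 1) % l.length = 0 := by rw [le_antisymm hge hk, Nat.mod_self]
    simp only [hmod]
    refine .inr fun x hx => ?_
    obtain ⟨m, hm, rfl⟩ := hmem x hx
    rw [hmono, hmono]
    omega

section Kreweras

variable {n : ℕ} {π : SetPartition n}

lemma part_blockPerm (π : SetPartition n) (i : Fin n) : π.part (blockPerm π i) = π.part i :=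
  mem_part_iff.1 <| (mem_sort _).1 <|
    List.formPerm_apply_mem_of_mem <| (mem_sort (· ≤ ·)).2 (self_mem_part π i)

lemma blockPerm_apply (π : SetPartition n) (i : Fin n) :
    (i < blockPerm π i ∧ ∀ x, π.part x = π.part i → x ≤ i ∨ blockPerm π i ≤ x) ∨
      ∀ x, π.part x = π.part i → x ≤ i ∧ blockPerm π i ≤ x := by
  simp only [← mem_part_iff]
  exact formPerm_sort_apply (self_mem_part π i)

/-- The permutation `π⁻¹ (1, 2, …, n)`, whose cycles are the blocks of the Kreweras complement. -/
noncomputable def krewerasPerm (π : SetPartition n) : Equiv.Perm (Fin n) :=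
  (blockPerm π)⁻¹ * finRotate n

lemma blockPerm_krewerasPerm (π : SetPartition n) (a : Fin n) :
    blockPerm π (krewerasPerm π a) = finRotate n a := by
  simp [krewerasPerm]

lemma part_krewerasPerm (π : SetPartition n) (a : Fin n) :
    π.part (krewerasPerm π a) = π.part (finRotate n a) := by
  rw [← blockPerm_krewerasPerm, part_blockPerm]

lemma part_kreweras_eq_iff_sameCycle {a b : Fin n} :
    (kreweras π).part a = (kreweras π).part b ↔ (krewerasPerm π).SameCycle a b :=
  letI : DecidableRel (Equiv.Perm.SameCycle.setoid (krewerasPerm π)).r := fun a b =>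
    inferInstanceAs (Decidable ((krewerasPerm π).SameCycle a b))
  part_ofSetoid_eq_iff (Equiv.Perm.SameCycle.setoid (krewerasPerm π))

lemma val_finRotate_of_lt {a b : Fin n} (h : a < b) : (finRotate n a : ℕ) = a + 1 := by
  obtain ⟨m, rfl⟩ : ∃ m, n = m + 1 := ⟨n - 1, by omega⟩
  exact coe_finRotate_of_ne_last (h.trans_le (Fin.le_last b)).ne

lemma krewerasPerm_mem_Ico (hπ : IsNoncrossing π) {i j a : Fin n} (hij : π.part i = π.part j)
    (ha : a ∈ Set.Ico i j) : krewerasPerm π a ∈ Set.Ico i j := by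
  rw [isNoncrossing_iff_part] at hπ
  have hc : (finRotate n a : ℕ) = a + 1 := val_finRotate_of_lt ha.2
  have hyc := part_krewerasPerm π a
  have hs := blockPerm_apply π (krewerasPerm π a)
  rw [blockPerm_krewerasPerm] at hs
  generalize krewerasPerm π a = y at *
  generalize finRotate n a = c at *
  obtain ⟨hic, hcj⟩ : i < c ∧ c ≤ j := by
    rw [Set.mem_Ico] at ha
    omega
  by_cases hci : π.part c = π.part i
  · rcases hs with ⟨h₁, h₂⟩ | h
    · have hi := h₂ i (hci.symm.trans hyc.symm)
      rw [Set.mem_Ico]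
      omega
    · exact absurd (h i (hci.symm.trans hyc.symm)).2 hic.not_ge
  · have hcj' : c < j := lt_of_le_of_ne hcj fun h => hci (by rw [h, hij])
    refine ⟨not_lt.1 fun hyi => ?_, not_le.1 fun hjy => ?_⟩
    · exact hci (hyc.symm.trans (hπ y i c j hyi hic hcj' hyc hij))
    · have hjy' : j < y := lt_of_le_of_ne hjy fun h => hci (by rw [← hyc, ← h, hij])
      exact hci (hπ i c j y hic hcj' hjy' hij hyc.symm).symm

lemma sameCycle_mem_Ico (hπ : IsNoncrossing π) {i j a b : Fin n} (hij : π.part i = π.part j)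
    (hab : (krewerasPerm π).SameCycle a b) (ha : a ∈ Set.Ico i j) : b ∈ Set.Ico i j := by
  obtain ⟨m, -, rfl⟩ := hab.exists_pow_eq'
  rw [Equiv.Perm.coe_pow]
  exact Set.MapsTo.iterate (fun _ hx => krewerasPerm_mem_Ico hπ hij hx) m ha

lemma sameCycle_of_le_runPartition {a b : Fin n} (hab : a < b) (h : π ≤ runPartition {a, b}) :
    (krewerasPerm π).SameCycle a b := by
  by_contra hcycle
  have hstep : ∀ c ∈ Set.Ico a b, krewerasPerm π c ∈ Set.Ioc a b := fun c hc => by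
    have hsame : SameRun {a, b} (krewerasPerm π c) (finRotate n c) :=
      part_runPartition_eq_iff.1 (le_iff_part.1 h _ _ (part_krewerasPerm π c))
    rw [hsame a (by simp) b (by simp), Set.mem_Ioc, Fin.lt_def, Fin.le_def,
      val_finRotate_of_lt hc.2]
    rw [Set.mem_Ico] at hc
    omega
  have horbit (k : ℕ) : (krewerasPerm π ^ k) a ∈ Set.Ico a b := by
    induction k with
    | zero => exact ⟨le_rfl, hab⟩
    | succ k ih =>
      rw [pow_succ', Equiv.Perm.mul_apply]
      refine ⟨(hstep _ ih).1.le, lt_of_le_of_ne (hstep _ ih).2 fun hb => hcycle ⟨(k + 1 : ℕ), ?_⟩⟩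
      rw [zpow_natCast, pow_succ', Equiv.Perm.mul_apply, hb]
  have hreturn := hstep _ (horbit (orderOf (krewerasPerm π) - 1))
  rw [← Equiv.Perm.mul_apply, ← pow_succ', Nat.sub_add_cancel (orderOf_pos _), pow_orderOf_eq_one,
    Equiv.Perm.one_apply] at hreturn
  exact lt_irrefl a hreturn.1

lemma part_kreweras_eq_iff (hπ : IsNoncrossing π) {a b : Fin n} :
    (kreweras π).part a = (kreweras π).part b ↔ π ≤ runPartition {a, b} := by
  wlog hab : a < b generalizing a b
  · rcases (not_lt.1 hab).eq_or_lt with rfl | hba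
    · exact iff_of_true rfl (by rw [pair_eq_singleton, runPartition_singleton]; exact le_top)
    · rw [eq_comm, pair_comm, this hba]
  rw [part_kreweras_eq_iff_sameCycle]
  refine ⟨fun hcycle => le_iff_part.2 fun i j hij => ?_, sameCycle_of_le_runPartition hab⟩
  have hij' : a ∈ Set.Ico i j ↔ b ∈ Set.Ico i j :=
    ⟨sameCycle_mem_Ico hπ hij hcycle, sameCycle_mem_Ico hπ hij hcycle.symm⟩
  have hji' : a ∈ Set.Ico j i ↔ b ∈ Set.Ico j i :=
    ⟨sameCycle_mem_Ico hπ hij.symm hcycle, sameCycle_mem_Ico hπ hij.symm hcycle.symm⟩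
  rw [part_runPartition_eq_iff]
  simp only [SameRun, mem_insert, mem_singleton, forall_eq_or_imp, forall_eq, Set.mem_Ico,
    Set.mem_Ioc] at *
  omega

end Kreweras

section Pointed

variable {n : ℕ} {π : SetPartition n} {W : Finset (Fin n)}

/-- The equivalence relation that identifies the elements of `W`. -/
def pointedSetoid (W : Finset (Fin n)) : Setoid (Fin n) where
  r i j := i = j ∨ i ∈ W ∧ j ∈ W
  iseqv := ⟨fun _ => .inl rfl, by tauto, by rintro i j k (rfl | hij) (rfl | hjk) <;> tauto⟩

instance (W : Finset (Fin n)) : DecidableRel (pointedSetoid W).r :=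
  fun i j => inferInstanceAs (Decidable (i = j ∨ i ∈ W ∧ j ∈ W))

/-- The partition of `[n]` with the block `W` in which every other block is a singleton. -/
def pointedPartition (W : Finset (Fin n)) : SetPartition n :=
  Finpartition.ofSetoid (pointedSetoid W)

lemma part_pointedPartition_eq_iff {i j : Fin n} :
    (pointedPartition W).part i = (pointedPartition W).part j ↔ i = j ∨ i ∈ W ∧ j ∈ W :=
  part_ofSetoid_eq_iff (pointedSetoid W)

lemma isNoncrossing_pointedPartition (W : Finset (Fin n)) :
    IsNoncrossing (pointedPartition W) := by
  rw [isNoncrossing_iff_part]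
  intro a b c d hab hbc hcd hac hbd
  rw [part_pointedPartition_eq_iff] at *
  exact .inr ⟨(hac.resolve_left (hab.trans hbc).ne).1, (hbd.resolve_left (hbc.trans hcd).ne).1⟩

lemma eq_pointedPartition_iff (hW : W.Nonempty) :
    π = pointedPartition W ↔ W ∈ π.parts ∧ ∀ V ∈ π.parts.erase W, #V = 1 := by
  constructor
  · rintro rfl
    have hpart : ∀ w ∈ W, (pointedPartition W).part w = W := fun w hw => by
      ext i
      rw [mem_part_iff, part_pointedPartition_eq_iff]
      exact ⟨by rintro (rfl | h) <;> tauto, fun hi => .inr ⟨hi, hw⟩⟩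
    obtain ⟨w, hw⟩ := hW
    refine ⟨by simpa only [hpart w hw] using part_mem_parts (pointedPartition W) w,
      fun V hV => card_eq_one.2 ?_⟩
    rw [parts_eq_image_part, mem_erase, mem_image] at hV
    obtain ⟨hne, j, -, rfl⟩ := hV
    refine ⟨j, ext fun i => ?_⟩
    rw [mem_part_iff, part_pointedPartition_eq_iff, mem_singleton]
    exact or_iff_left fun h => hne (hpart j h.2)
  · rintro ⟨hmem, hone⟩
    refine setPartition_ext fun i j => ?_
    rw [part_pointedPartition_eq_iff]
    constructor
    · intro hij
      by_cases hW : π.part j = W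
      · exact .inr (hW ▸ ⟨mem_part_iff.2 hij, self_mem_part π j⟩)
      · exact .inl <| card_le_one.1 (hone _ (mem_erase.2 ⟨hW, part_mem_parts π j⟩)).le _
          (mem_part_iff.2 hij) _ (self_mem_part π j)
    · rintro (rfl | ⟨hi, hj⟩)
      · rfl
      · rw [π.part_eq_of_mem hmem hi, π.part_eq_of_mem hmem hj]

lemma pointedPartition_singleton (w : Fin n) : pointedPartition {w} = ⊥ := by
  refine ((eq_pointedPartition_iff (singleton_nonempty w)).2 ⟨?_, fun V hV => ?_⟩).symm
  · exact (Finpartition.mem_bot_iff).2 ⟨w, mem_univ w, rfl⟩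
  · obtain ⟨a, -, rfl⟩ := Finpartition.mem_bot_iff.1 (mem_of_mem_erase hV)
    exact card_singleton a

lemma sameRun_finRotate {b : Fin n} (hb : b ∉ W) : SameRun W b (finRotate n b) := by
  obtain ⟨m, rfl⟩ := Nat.exists_eq_add_one_of_ne_zero b.pos.ne'
  intro w hw w' hw'
  have hwb : w ≠ b := fun h => hb (h ▸ hw)
  have hwb' : w' ≠ b := fun h => hb (h ▸ hw')
  rcases (Fin.le_last b).eq_or_lt with rfl | hlt
  · rw [finRotate_last]
    simp only [Set.mem_Ioc, Fin.lt_def, Fin.le_def, Fin.val_last, Fin.val_zero, Fin.ext_iff,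
      ne_eq] at *
    omega
  · have := val_finRotate_of_lt hlt
    simp only [Set.mem_Ioc, Fin.lt_def, Fin.le_def, Fin.ext_iff, ne_eq] at *
    omega

lemma mem_of_runPartition_le {a b : Fin n} (hab : a ≠ b)
    (h : runPartition W ≤ runPartition {a, b}) : a ∈ W := by
  by_contra ha
  have hsame := part_runPartition_eq_iff.1 <|
    le_iff_part.1 h _ _ (part_runPartition_eq_iff.2 (sameRun_finRotate ha))
  have hab' := hsame a (by simp) b (by simp)
  have hba' := hsame b (by simp) a (by simp)
  rcases hab.lt_or_gt with hlt | hlt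
  · have := val_finRotate_of_lt hlt
    simp only [Set.mem_Ioc, Fin.lt_def, Fin.le_def] at *
    omega
  · obtain ⟨m, rfl⟩ : ∃ m, n = m + 1 := ⟨n - 1, by omega⟩
    rcases (Fin.le_last a).eq_or_lt with rfl | hlast
    · rw [finRotate_last] at hba'
      simp only [Set.mem_Ioc, Fin.lt_def, Fin.le_def, Fin.val_zero] at *
      omega
    · have := val_finRotate_of_lt hlast
      simp only [Set.mem_Ioc, Fin.lt_def, Fin.le_def] at *
      omega

lemma kreweras_runPartition (W : Finset (Fin n)) :
    kreweras (runPartition W) = pointedPartition W := by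
  refine setPartition_ext fun a b => ?_
  rw [part_kreweras_eq_iff (isNoncrossing_runPartition W), part_pointedPartition_eq_iff]
  constructor
  · intro h
    refine or_iff_not_imp_left.2 fun hab => ⟨mem_of_runPartition_le hab h, ?_⟩
    rw [pair_comm] at h
    exact mem_of_runPartition_le (Ne.symm hab) h
  · rintro (rfl | ⟨ha, hb⟩)
    · rw [pair_eq_singleton, runPartition_singleton]
      exact le_top
    · refine le_iff_part.2 fun i j hij => part_runPartition_eq_iff.2 ?_
      exact (part_runPartition_eq_iff.1 hij).mono (insert_subset ha (singleton_subset_iff.2 hb))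

lemma part_finRotate_of_kreweras_eq_pointedPartition (h : kreweras π = pointedPartition W)
    {a : Fin n} (ha : a ∉ W) : π.part (finRotate n a) = π.part a := by
  have hsame : (kreweras π).part (krewerasPerm π a) = (kreweras π).part a :=
    part_kreweras_eq_iff_sameCycle.2 (Equiv.Perm.sameCycle_apply_left.2 (.refl _ _))
  rw [h, part_pointedPartition_eq_iff, or_iff_left fun h => ha h.2] at hsame
  rw [← part_krewerasPerm, hsame]

open Fin.NatCast in
lemma exists_part_eq_of_kreweras_eq_pointedPartition (h : kreweras π = pointedPartition W)
    (hW : W.Nonempty) (i : Fin n) : ∃ w ∈ W, π.part i = π.part w := by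
  obtain ⟨m, rfl⟩ := Nat.exists_eq_add_one_of_ne_zero i.pos.ne'
  by_contra! hi
  have hconst (k : ℕ) : π.part (i + (k : Fin (m + 1))) = π.part i := by
    induction k with
    | zero => rw [Nat.cast_zero, add_zero]
    | succ k ih =>
      have hk : i + (k : Fin (m + 1)) ∉ W := fun hmem => hi _ hmem ih.symm
      rw [Nat.cast_succ, ← add_assoc, ← finRotate_apply,
        part_finRotate_of_kreweras_eq_pointedPartition h hk, ih]
  obtain ⟨w, hw⟩ := hW
  refine hi w hw (Eq.symm ?_)
  simpa only [Fin.cast_val_eq_self, add_sub_cancel] using hconst (w - i : Fin (m + 1)).val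

theorem kreweras_eq_pointedPartition_iff (hπ : IsNoncrossing π) (hW : W.Nonempty) :
    kreweras π = pointedPartition W ↔ π = runPartition W := by
  refine ⟨fun h => ?_, fun h => h ▸ kreweras_runPartition W⟩
  have hle : π ≤ runPartition W := by
    refine le_iff_part.2 fun i j hij => part_runPartition_eq_iff.2 fun w hw w' hw' => ?_
    have hpair : π ≤ runPartition {w, w'} := by
      rw [← part_kreweras_eq_iff hπ, h, part_pointedPartition_eq_iff]
      exact .inr ⟨hw, hw'⟩
    exact part_runPartition_eq_iff.1 (le_iff_part.1 hpair i j hij) w (by simp) w' (by simp)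
  refine le_antisymm hle (le_iff_part.2 fun i j hij => ?_)
  obtain ⟨w, hw, hiw⟩ := exists_part_eq_of_kreweras_eq_pointedPartition h hW i
  obtain ⟨w', hw', hjw'⟩ := exists_part_eq_of_kreweras_eq_pointedPartition h hW j
  have hww' : w = w' := by
    refine SameRun.eq_of_mem hw hw' (part_runPartition_eq_iff.1 ?_)
    rw [← le_iff_part.1 hle i w hiw, hij, le_iff_part.1 hle j w' hjw']
  rw [hiw, hww', hjw']

end Pointed

/-! ### Cumulants of a unit point mass -/

section Cumulants

variable {n : ℕ} {m m' u v c : ℕ → ℝ}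

lemma card_ne_zero_of_mem_parts {π : SetPartition n} {V : Finset (Fin n)} (hV : V ∈ π.parts) :
    #V ≠ 0 :=
  (card_pos.2 (π.nonempty_of_mem_parts hV)).ne'

lemma blockProd_congr (h : ∀ k, k ≠ 0 → u k = v k) (π : SetPartition n) :
    blockProd u π = blockProd v π :=
  prod_congr rfl fun _ hV => h _ (card_ne_zero_of_mem_parts hV)

lemma blockDeriv_congr_left (h : ∀ k, k ≠ 0 → u k = v k) (c : ℕ → ℝ) (π : SetPartition n) :
    blockDeriv u c π = blockDeriv v c π :=
  sum_congr rfl fun _ _ => congrArg _ <|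
    prod_congr rfl fun _ hW => h _ (card_ne_zero_of_mem_parts (mem_of_mem_erase hW))

lemma blockDeriv_congr_right (h : ∀ k, k ≠ 0 → u k = v k) (r : ℕ → ℝ) (π : SetPartition n) :
    blockDeriv r u π = blockDeriv r v π :=
  sum_congr rfl fun _ hV => congrArg (· * _) (h _ (card_ne_zero_of_mem_parts hV))

lemma blockDeriv_add (r u v : ℕ → ℝ) (π : SetPartition n) :
    blockDeriv r (u + v) π = blockDeriv r u π + blockDeriv r v π := by
  simp only [blockDeriv, Pi.add_apply, add_mul, sum_add_distrib]

lemma blockProd_top (hn : n ≠ 0) (u : ℕ → ℝ) : blockProd u (⊤ : SetPartition n) = u n := by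
  rw [blockProd, parts_top hn, prod_singleton, card_fin]

lemma blockDeriv_top (hn : n ≠ 0) (u c : ℕ → ℝ) : blockDeriv u c (⊤ : SetPartition n) = c n := by
  rw [blockDeriv, parts_top hn, sum_singleton, erase_singleton, prod_empty, mul_one, card_fin]

lemma freeCumulant_eq (h : ∀ n, n ≠ 0 → m n = ∑ π ∈ NC n, blockProd u π) (hn : n ≠ 0) :
    freeCumulant m n = u n := by
  induction n using Nat.strong_induction_on with
  | _ n ih =>
    have hsum := (moment_eq_sum_freeCumulant m hn).symm.trans (h n hn)
    rw [← add_sum_erase _ _ (top_mem_NC n), ← add_sum_erase _ _ (top_mem_NC n), blockProd_top hn,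
      blockProd_top hn] at hsum
    refine add_right_cancel (hsum.trans (congrArg _ (sum_congr rfl fun π hπ => ?_)))
    exact prod_congr rfl fun V hV =>
      (ih _ (card_lt_of_ne_top (ne_of_mem_erase hπ) hV) (card_ne_zero_of_mem_parts hV)).symm

lemma infFreeCumulant_eq (h : ∀ n, n ≠ 0 → m' n = ∑ π ∈ NC n, blockDeriv (freeCumulant m) c π)
    (hn : n ≠ 0) : infFreeCumulant m m' n = c n := by
  induction n using Nat.strong_induction_on with
  | _ n ih =>
    have hsum := (infMoment_eq_sum_infFreeCumulant m m' hn).symm.trans (h n hn)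
    rw [← add_sum_erase _ _ (top_mem_NC n), ← add_sum_erase _ _ (top_mem_NC n), blockDeriv_top hn,
      blockDeriv_top hn] at hsum
    refine add_right_cancel (hsum.trans (congrArg _ (sum_congr rfl fun π hπ => ?_)))
    exact sum_congr rfl fun V hV => congrArg (· * _)
      (ih _ (card_lt_of_ne_top (ne_of_mem_erase hπ) hV) (card_ne_zero_of_mem_parts hV)).symm

lemma eq_bot_iff_card_eq_one {π : SetPartition n} : π = ⊥ ↔ ∀ V ∈ π.parts, #V = 1 := by
  constructor
  · rintro rfl V hV
    obtain ⟨a, -, rfl⟩ := Finpartition.mem_bot_iff.1 hV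
    exact card_singleton a
  · refine fun h => eq_bot_iff.2 fun V hV => ?_
    obtain ⟨a, rfl⟩ := card_eq_one.1 (h V hV)
    exact ⟨{a}, Finpartition.mem_bot_iff.2 ⟨a, mem_univ a, rfl⟩, Subset.rfl⟩

lemma prod_single_one_card (P : Finset (Finset (Fin n))) :
    ∏ V ∈ P, (Pi.single 1 1 : ℕ → ℝ) #V = if ∀ V ∈ P, #V = 1 then 1 else 0 := by
  simp only [Pi.single_apply, prod_ite_zero, prod_const_one]

lemma blockProd_single_one (π : SetPartition n) :
    blockProd (Pi.single 1 1) π = if π = ⊥ then 1 else 0 := by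
  simp only [blockProd, prod_single_one_card, eq_bot_iff_card_eq_one]

lemma blockDeriv_single_one (c : ℕ → ℝ) (π : SetPartition n) :
    blockDeriv (Pi.single 1 1) c π =
      ∑ W : Finset (Fin n) with W.Nonempty, if π = pointedPartition W then c #W else 0 := by
  have hsub : π.parts ⊆ univ.filter Finset.Nonempty := fun V hV =>
    mem_filter.2 ⟨mem_univ V, π.nonempty_of_mem_parts hV⟩
  simp only [blockDeriv, prod_single_one_card, mul_ite, mul_one, mul_zero]
  rw [← sum_subset hsub fun W hW hWπ => if_neg fun h =>
    hWπ ((eq_pointedPartition_iff (mem_filter.1 hW).2).1 h).1]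
  refine sum_congr rfl fun W hW => if_congr ?_ rfl rfl
  rw [eq_pointedPartition_iff (π.nonempty_of_mem_parts hW), and_iff_right hW]

lemma sum_NC_blockProd_single_one (hn : n ≠ 0) :
    ∑ π ∈ NC n, blockProd (Pi.single 1 1) π = 1 := by
  have hbot : (⊥ : SetPartition n) ∈ NC n := by
    rw [← pointedPartition_singleton ⟨0, Nat.pos_of_ne_zero hn⟩]
    exact mem_NC.2 (isNoncrossing_pointedPartition _)
  simp only [blockProd_single_one, sum_ite_eq', if_pos hbot]

lemma sum_NC_blockDeriv_single_one (c : ℕ → ℝ) :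
    ∑ π ∈ NC n, blockDeriv (Pi.single 1 1) c π =
      ∑ W : Finset (Fin n) with W.Nonempty, c #W := by
  simp only [blockDeriv_single_one]
  rw [sum_comm]
  refine sum_congr rfl fun W _ => ?_
  rw [sum_ite_eq', if_pos (mem_NC.2 (isNoncrossing_pointedPartition W))]

lemma kreweras_eq_bot_iff (hn : n ≠ 0) {π : SetPartition n} (hπ : IsNoncrossing π) :
    kreweras π = ⊥ ↔ π = ⊤ := by
  rw [← pointedPartition_singleton ⟨0, Nat.pos_of_ne_zero hn⟩,
    kreweras_eq_pointedPartition_iff hπ (singleton_nonempty _), runPartition_singleton]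

lemma sum_NC_mul_blockProd_kreweras_single_one (hn : n ≠ 0) (F : SetPartition n → ℝ) :
    ∑ π ∈ NC n, F π * blockProd (Pi.single 1 1) (kreweras π) = F ⊤ := by
  rw [sum_eq_single_of_mem ⊤ (top_mem_NC n) fun π hπ hne => ?_]
  · rw [blockProd_single_one, if_pos ((kreweras_eq_bot_iff hn (mem_NC.1 (top_mem_NC n))).2 rfl),
      mul_one]
  · rw [blockProd_single_one, if_neg (mt (kreweras_eq_bot_iff hn (mem_NC.1 hπ)).1 hne), mul_zero]

lemma sum_NC_mul_blockDeriv_kreweras_single_one (F : SetPartition n → ℝ) (c : ℕ → ℝ) :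
    ∑ π ∈ NC n, F π * blockDeriv (Pi.single 1 1) c (kreweras π) =
      ∑ W : Finset (Fin n) with W.Nonempty, c #W * F (runPartition W) := by
  simp only [blockDeriv_single_one, mul_sum]
  rw [sum_comm]
  refine sum_congr rfl fun W hW => ?_
  have hterm : ∀ π ∈ NC n, (F π * if kreweras π = pointedPartition W then c #W else 0) =
      if π = runPartition W then c #W * F (runPartition W) else 0 := fun π hπ => by
    rw [mul_ite, mul_zero, if_congr (kreweras_eq_pointedPartition_iff (mem_NC.1 hπ)
      (mem_filter.1 hW).2) rfl rfl]
    split_ifs with h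
    · rw [h, mul_comm]
    · rfl
  rw [sum_congr rfl hterm, sum_ite_eq', if_pos (mem_NC.2 (isNoncrossing_runPartition W))]

lemma measureMoment_dirac_one (n : ℕ) : measureMoment (.dirac 1) n = 1 := by
  rw [measureMoment, integral_dirac, one_pow]

lemma freeCumulants_dirac_one (hn : n ≠ 0) :
    freeCumulants (.dirac 1) n = (Pi.single 1 1 : ℕ → ℝ) n :=
  freeCumulant_eq (fun n hn => by
    rw [measureMoment_dirac_one, sum_NC_blockProd_single_one hn]) hn

lemma functionalMoment_eq_sum_map_X_sub_one_pow {φ : ℝ[X] →ₗ[ℝ] ℝ} (hφ : φ 1 = 0) (n : ℕ) :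
    functionalMoment φ n = ∑ W : Finset (Fin n) with W.Nonempty, φ ((X - 1) ^ #W) := by
  have hbinom : (X : ℝ[X]) ^ n = ∑ W : Finset (Fin n), (X - 1) ^ #W := by
    have hpow := Fintype.sum_pow_mul_eq_add_pow (Fin n) (X - 1 : ℝ[X]) 1
    rw [sub_add_cancel, Fintype.card_fin] at hpow
    simpa only [one_pow, mul_one] using hpow.symm
  rw [functionalMoment, hbinom, map_sum]
  refine (sum_subset (filter_subset _ _) fun W _ hW => ?_).symm
  have hW : W = ∅ := by simpa using hW
  rw [hW, card_empty, pow_zero, hφ]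

lemma infFreeCumulants_dirac_one {φ : ℝ[X] →ₗ[ℝ] ℝ} (hφ : φ 1 = 0) (hn : n ≠ 0) :
    infFreeCumulants (.dirac 1) φ n = φ ((X - 1) ^ n) := by
  refine infFreeCumulant_eq (c := fun n => φ ((X - 1) ^ n)) (fun n _ => ?_) hn
  rw [functionalMoment_eq_sum_map_X_sub_one_pow hφ]
  refine (sum_NC_blockDeriv_single_one fun n => φ ((X - 1) ^ n)).symm.trans ?_
  exact sum_congr rfl fun π _ =>
    blockDeriv_congr_left (fun k hk => (freeCumulants_dirac_one hk).symm) _ π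

end Cumulants

/-! ### Non-crossing partitions with a marked block -/

section MarkedBlock

variable {n k : ℕ}

/-- The non-crossing condition for a family of blocks; `IsNoncrossing π` is the case
`P = π.parts`. It makes sense for partitions of subsets of `[n]`. -/
def IsNoncrossingFamily (P : Finset (Finset (Fin n))) : Prop :=
  ∀ a b c d : Fin n, a < b → b < c → c < d →
    ∀ V ∈ P, ∀ W ∈ P, a ∈ V → c ∈ V → b ∈ W → d ∈ W → V = W

instance : DecidablePred (IsNoncrossingFamily (n := n)) :=
  fun _ => by unfold IsNoncrossingFamily; infer_instance

/-- The image of a partition of `[k]` under an embedding of `[k]` into `[n]`. -/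
def mapPartition (e : Fin k ↪ Fin n) (π : SetPartition k) : Finpartition (univ.map e) :=
  .ofExistsUnique (π.parts.map (mapEmbedding e).toEmbedding)
    (by
      simp only [forall_mem_map]
      exact fun V _ => map_subset_map.2 (subset_univ V))
    (by
      simp only [forall_mem_map]
      intro i _
      refine ⟨(π.part i).map e, ⟨mem_map_of_mem _ (part_mem_parts π i),
        mem_map_of_mem e (self_mem_part π i)⟩, ?_⟩
      rintro _ ⟨hW, hi⟩
      obtain ⟨V, hV, rfl⟩ := mem_map.1 hW
      exact congrArg (Finset.map e) (π.part_eq_of_mem hV ((mem_map' e).1 hi)).symm)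
    (by
      intro h
      obtain ⟨V, hV, hVe⟩ := mem_map.1 h
      exact π.ne_empty hV (map_eq_empty.1 hVe))

lemma parts_mapPartition (e : Fin k ↪ Fin n) (π : SetPartition k) :
    (mapPartition e π).parts = π.parts.map (mapEmbedding e).toEmbedding := rfl

lemma mapPartition_bijective (e : Fin k ↪ Fin n) : Function.Bijective (mapPartition e) := by
  constructor
  · exact fun π π' h => Finpartition.ext (map_injective _ (congrArg Finpartition.parts h))
  · intro P
    have hmem (i : Fin k) : e i ∈ univ.map e := mem_map_of_mem e (mem_univ i)
    let s : Setoid (Fin k) := (Setoid.ker P.part).comap e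
    let : DecidableRel s.r := fun i j => inferInstanceAs (Decidable (P.part (e i) = P.part (e j)))
    have hpart (i : Fin k) : ((Finpartition.ofSetoid s).part i).map e = P.part (e i) := by
      ext x
      constructor
      · intro hx
        obtain ⟨j, hj, rfl⟩ := mem_map.1 hx
        rw [P.mem_part_iff_part_eq_part (hmem j) (hmem i)]
        exact (part_ofSetoid_eq_iff s).1 (mem_part_iff.1 hj)
      · intro hx
        obtain ⟨j, -, rfl⟩ := mem_map.1 (P.part_subset _ hx)
        refine mem_map_of_mem e (mem_part_iff.2 ((part_ofSetoid_eq_iff s).2 ?_))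
        exact (P.mem_part_iff_part_eq_part (hmem j) (hmem i)).1 hx
    refine ⟨.ofSetoid s, Finpartition.ext (Finset.ext fun B => ?_)⟩
    rw [parts_mapPartition, parts_eq_image_part]
    simp only [Finset.mem_map, mem_image, mem_univ, true_and, RelEmbedding.coe_toEmbedding,
      mapEmbedding_apply, exists_exists_eq_and, hpart]
    constructor
    · rintro ⟨i, rfl⟩
      exact P.part_mem.2 (hmem i)
    · intro hB
      obtain ⟨x, hx⟩ := P.nonempty_of_mem_parts hB
      obtain ⟨i, -, rfl⟩ := mem_map.1 (P.subset hB hx)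
      exact ⟨i, P.part_eq_of_mem hB hx⟩

lemma isNoncrossingFamily_mapPartition (e : Fin k ↪o Fin n) (π : SetPartition k) :
    IsNoncrossingFamily (mapPartition e.toEmbedding π).parts ↔ IsNoncrossing π := by
  rw [parts_mapPartition]
  constructor
  · intro h a b c d hab hbc hcd V hV W hW ha hc hb hd
    refine map_injective e.toEmbedding (h (e a) (e b) (e c) (e d) (e.lt_iff_lt.2 hab)
      (e.lt_iff_lt.2 hbc) (e.lt_iff_lt.2 hcd) _ (mem_map_of_mem _ hV) _ (mem_map_of_mem _ hW)
      ?_ ?_ ?_ ?_)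
    all_goals exact mem_map_of_mem _ ‹_›
  · intro h a b c d hab hbc hcd V hV W hW ha hc hb hd
    obtain ⟨V, hV', rfl⟩ := mem_map.1 hV
    obtain ⟨W, hW', rfl⟩ := mem_map.1 hW
    obtain ⟨a, ha', rfl⟩ := mem_map.1 ha
    obtain ⟨b, hb', rfl⟩ := mem_map.1 hb
    obtain ⟨c, hc', rfl⟩ := mem_map.1 hc
    obtain ⟨d, hd', rfl⟩ := mem_map.1 hd
    exact congrArg (Finset.map e.toEmbedding) (h a b c d (e.lt_iff_lt.1 hab) (e.lt_iff_lt.1 hbc)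
      (e.lt_iff_lt.1 hcd) V hV' W hW' ha' hc' hb' hd')

/-- The moments `m_n = ∑_{π ∈ NC(n)} r_π` with free cumulants `r_n`; `m_0 = 1`. -/
def momentOfCumulant (r : ℕ → ℝ) (n : ℕ) : ℝ := ∑ π ∈ NC n, blockProd r π

lemma sum_noncrossing_finpartition (r : ℕ → ℝ) (S : Finset (Fin n)) :
    ∑ P : Finpartition S with IsNoncrossingFamily P.parts, ∏ B ∈ P.parts, r #B =
      momentOfCumulant r #S := by
  suffices h : ∀ (k : ℕ) (e : Fin k ↪o Fin n),
      ∑ P : Finpartition (univ.map e.toEmbedding) with IsNoncrossingFamily P.parts,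
        ∏ B ∈ P.parts, r #B = momentOfCumulant r k by
    have hS := h #S (S.orderEmbOfFin rfl)
    rwa [map_orderEmbOfFin_univ] at hS
  intro k e
  refine (sum_bijective _ (mapPartition_bijective e.toEmbedding) (fun π => ?_) fun π _ => ?_).symm
  · rw [mem_NC, mem_filter, isNoncrossingFamily_mapPartition, and_iff_right (mem_univ _)]
  · simp only [blockProd, parts_mapPartition, prod_map, RelEmbedding.coe_toEmbedding,
      mapEmbedding_apply, card_map]

/-- The run of `V` that ends in `v`, without `v` itself. -/
def gap (V : Finset (Fin n)) (v : Fin n) : Finset (Fin n) := ((runPartition V).part v).erase v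

variable {V B : Finset (Fin n)} {v w i j : Fin n} {σ : SetPartition n}

lemma mem_gap : i ∈ gap V v ↔ i ≠ v ∧ SameRun V i v := by
  rw [gap, mem_erase, mem_part_iff, part_runPartition_eq_iff]

lemma card_gap (V : Finset (Fin n)) (v : Fin n) :
    #(gap V v) = #((runPartition V).part v) - 1 :=
  card_erase_of_mem (self_mem_part _ v)

lemma notMem_of_mem_gap (hv : v ∈ V) (hi : i ∈ gap V v) : i ∉ V := fun hiV =>
  (mem_gap.1 hi).1 (SameRun.eq_of_mem hiV hv (mem_gap.1 hi).2)

lemma eq_of_mem_gap (hv : v ∈ V) (hw : w ∈ V) (hiv : i ∈ gap V v) (hiw : i ∈ gap V w) : v = w :=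
  SameRun.eq_of_mem hv hw ((mem_gap.1 hiv).2.symm.trans (mem_gap.1 hiw).2)

lemma exists_mem_gap (hV : V.Nonempty) (hi : i ∉ V) : ∃ v ∈ V, i ∈ gap V v := by
  obtain ⟨v, hv, hiv⟩ := exists_sameRun hV i
  exact ⟨v, hv, mem_gap.2 ⟨fun h => hi (h ▸ hv), hiv⟩⟩

lemma supIndep_gap (V : Finset (Fin n)) : (univ : Finset V).SupIndep fun v => gap V v := by
  rw [supIndep_iff_pairwiseDisjoint]
  refine fun v _ w _ hvw => Finset.disjoint_left.2 fun i hi hi' => hvw (Subtype.ext ?_)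
  exact eq_of_mem_gap v.2 w.2 hi hi'

/-- The partition of `[n]` formed by the block `V` and partitions of the gaps of `V`. -/
def gluePartition (hV : V.Nonempty) (p : ∀ v ∈ V, Finpartition (gap V v)) : SetPartition n :=
  (Finpartition.combine (fun v : V => p v v.2) (supIndep_gap V)).extend hV.ne_empty
    (Finset.disjoint_left.2 fun i hi hiV => by
      obtain ⟨v, -, hi⟩ := mem_sup.1 hi
      exact notMem_of_mem_gap v.2 hi hiV)
    (eq_univ_of_forall fun i => by
      by_cases hi : i ∈ V
      · exact mem_union_right _ hi
      · obtain ⟨v, hv, hiv⟩ := exists_mem_gap hV hi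
        exact mem_union_left _ (mem_sup.2 ⟨⟨v, hv⟩, mem_univ _, hiv⟩))

variable {hV : V.Nonempty} {p : ∀ v ∈ V, Finpartition (gap V v)}

lemma parts_gluePartition :
    (gluePartition hV p).parts = insert V (V.attach.biUnion fun v => (p v v.2).parts) := rfl

lemma mem_parts_gluePartition :
    B ∈ (gluePartition hV p).parts ↔ B = V ∨ ∃ v, ∃ hv : v ∈ V, B ∈ (p v hv).parts := by
  simp only [parts_gluePartition, mem_insert, mem_biUnion, mem_attach, true_and, Subtype.exists]

lemma ne_of_mem_parts_gap (hv : v ∈ V) {P : Finpartition (gap V v)} (hB : B ∈ P.parts) :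
    B ≠ V := by
  obtain ⟨i, hi⟩ := P.nonempty_of_mem_parts hB
  exact fun h => notMem_of_mem_gap hv (P.subset hB hi) (h ▸ hi)

lemma prod_parts_gluePartition_erase {M : Type*} [CommMonoid M] (f : Finset (Fin n) → M) :
    ∏ B ∈ (gluePartition hV p).parts.erase V, f B =
      ∏ v ∈ V.attach, ∏ B ∈ (p v v.2).parts, f B := by
  rw [parts_gluePartition, erase_insert, prod_biUnion]
  · refine fun v _ w _ hvw => Finset.disjoint_left.2 fun B hB hB' => hvw (Subtype.ext ?_)
    obtain ⟨i, hi⟩ := (p v v.2).nonempty_of_mem_parts hB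
    exact eq_of_mem_gap v.2 w.2 ((p v v.2).subset hB hi) ((p w w.2).subset hB' hi)
  · simp only [mem_biUnion, mem_attach, true_and, not_exists]
    exact fun v hB => ne_of_mem_parts_gap v.2 hB rfl

lemma isNoncrossing_gluePartition
    (hp : ∀ v, ∀ hv : v ∈ V, IsNoncrossingFamily (p v hv).parts) :
    IsNoncrossing (gluePartition hV p) := by
  have hrun : ∀ {v B}, ∀ hv : v ∈ V, B ∈ (p v hv).parts → ∀ i ∈ B, SameRun V i v :=
    fun hv hB i hi => (mem_gap.1 ((p _ hv).subset hB hi)).2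
  intro a b c d hab hbc hcd A hA B hB ha hc hb hd
  rcases mem_parts_gluePartition.1 hA with rfl | ⟨v, hv, hAv⟩ <;>
    rcases mem_parts_gluePartition.1 hB with rfl | ⟨w, hw, hBw⟩
  · rfl
  · have hsame := (hrun hw hBw b hb).trans (hrun hw hBw d hd).symm
    exact absurd ((hsame a ha c hc).1 ⟨hab, hbc.le⟩).2 hcd.not_ge
  · have hsame := (hrun hv hAv a ha).trans (hrun hv hAv c hc).symm
    exact absurd ((hsame b hb d hd).2 ⟨hbc, hcd.le⟩).1 hab.not_gt
  · have hac := (hrun hv hAv a ha).trans (hrun hv hAv c hc).symm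
    have hbd := (hrun hw hBw b hb).trans (hrun hw hBw d hd).symm
    have hab' : SameRun V a b := part_runPartition_eq_iff.1 <|
      isNoncrossing_iff_part.1 (isNoncrossing_runPartition V) a b c d hab hbc hcd
        (part_runPartition_eq_iff.2 hac) (part_runPartition_eq_iff.2 hbd)
    obtain rfl : v = w := SameRun.eq_of_mem hv hw
      ((hrun hv hAv a ha).symm.trans (hab'.trans (hrun hw hBw b hb)))
    exact hp v hv a b c d hab hbc hcd A hAv B hBw ha hc hb hd

lemma sameRun_of_mem_parts (hσ : IsNoncrossing σ) (hV : V ∈ σ.parts) (hB : B ∈ σ.parts)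
    (hBV : B ≠ V) (hi : i ∈ B) (hj : j ∈ B) : SameRun V i j := by
  suffices h : ∀ i ∈ B, ∀ j ∈ B, ∀ w ∈ V, ∀ w' ∈ V, i ∈ Set.Ioc w w' → j ∈ Set.Ioc w w' from
    fun w hw w' hw' => ⟨h i hi j hj w hw w' hw', h j hj i hi w hw w' hw'⟩
  intro i hi j hj w hw w' hw' hiw
  have hne : ∀ x ∈ B, ∀ u ∈ V, x ≠ u := fun x hx u hu h =>
    hBV (σ.eq_of_mem_parts hB hV hx (h ▸ hu))
  have hiw' : i < w' := lt_of_le_of_ne hiw.2 (hne i hi w' hw')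
  refine ⟨not_le.1 fun hjw => ?_, not_lt.1 fun hwj => ?_⟩
  · exact hBV (hσ j w i w' (lt_of_le_of_ne hjw (hne j hj w hw)) hiw.1 hiw' B hB V hV hj hi hw hw')
  · exact hBV (hσ w i w' j hiw.1 hiw' hwj V hV B hB hw hw' hi hj).symm

lemma subset_gap_of_mem_parts (hσ : IsNoncrossing σ) (hV : V ∈ σ.parts) (hB : B ∈ σ.parts)
    (hBV : B ≠ V) (hv : v ∈ V) (hi : i ∈ B) (hiv : i ∈ gap V v) : B ⊆ gap V v := fun _ hj =>
  mem_gap.2 ⟨fun h => hBV (σ.eq_of_mem_parts hB hV hj (h ▸ hv)),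
    (sameRun_of_mem_parts hσ hV hB hBV hj hi).trans (mem_gap.1 hiv).2⟩

lemma mem_parts_restrict_gap (hσ : IsNoncrossing σ) (hV : V ∈ σ.parts) (hv : v ∈ V) :
    B ∈ (σ.restrict (subset_univ (gap V v))).parts ↔ B ∈ σ.parts ∧ B ⊆ gap V v := by
  change B ∈ (σ.parts.image (· ∩ gap V v)).erase ∅ ↔ _
  rw [mem_erase, mem_image]
  constructor
  · rintro ⟨hne, A, hA, rfl⟩
    obtain ⟨i, hi⟩ := nonempty_iff_ne_empty.2 hne
    rw [mem_inter] at hi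
    have hAV : A ≠ V := fun h => notMem_of_mem_gap hv hi.2 (h ▸ hi.1)
    have hsub := subset_gap_of_mem_parts hσ hV hA hAV hv hi.1 hi.2
    rw [inter_eq_left.2 hsub]
    exact ⟨hA, hsub⟩
  · exact fun h => ⟨σ.ne_empty h.1, B, h.1, inter_eq_left.2 h.2⟩

lemma gluePartition_restrict (hσ : IsNoncrossing σ) (hVσ : V ∈ σ.parts) :
    gluePartition hV (fun v _ => σ.restrict (subset_univ (gap V v))) = σ := by
  refine Finpartition.ext (Finset.ext fun B => ?_)
  rw [mem_parts_gluePartition]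
  constructor
  · rintro (rfl | ⟨v, hv, hB⟩)
    · exact hVσ
    · exact ((mem_parts_restrict_gap hσ hVσ hv).1 hB).1
  · refine fun hB => or_iff_not_imp_left.2 fun hBV => ?_
    obtain ⟨i, hi⟩ := σ.nonempty_of_mem_parts hB
    obtain ⟨v, hv, hiv⟩ := exists_mem_gap hV fun h => hBV (σ.eq_of_mem_parts hB hVσ hi h)
    exact ⟨v, hv, (mem_parts_restrict_gap hσ hVσ hv).2
      ⟨hB, subset_gap_of_mem_parts hσ hVσ hB hBV hv hi hiv⟩⟩

lemma restrict_gluePartition (hp : ∀ v, ∀ hv : v ∈ V, IsNoncrossingFamily (p v hv).parts)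
    (hv : v ∈ V) : (gluePartition hV p).restrict (subset_univ (gap V v)) = p v hv := by
  refine Finpartition.ext (Finset.ext fun B => ?_)
  have hVglue : V ∈ (gluePartition hV p).parts := mem_parts_gluePartition.2 (.inl rfl)
  rw [mem_parts_restrict_gap (isNoncrossing_gluePartition hp) hVglue hv, mem_parts_gluePartition]
  constructor
  · rintro ⟨rfl | ⟨w, hw, hB⟩, hsub⟩
    · exact absurd hv (notMem_of_mem_gap hv (hsub hv))
    · obtain ⟨i, hi⟩ := (p w hw).nonempty_of_mem_parts hB
      obtain rfl := eq_of_mem_gap hv hw (hsub hi) ((p w hw).subset hB hi)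
      exact hB
  · exact fun hB => ⟨.inr ⟨v, hv, hB⟩, (p v hv).subset hB⟩

lemma sum_NC_prod_parts_erase {R : Type*} [CommSemiring R] (hV : V.Nonempty)
    (f : Finset (Fin n) → R) :
    ∑ σ ∈ NC n with V ∈ σ.parts, ∏ B ∈ σ.parts.erase V, f B =
      ∏ v ∈ V, ∑ P : Finpartition (gap V v) with IsNoncrossingFamily P.parts,
        ∏ B ∈ P.parts, f B := by
  rw [prod_sum]
  refine (sum_bij' (fun p _ => gluePartition hV p)
    (fun σ _ v _ => σ.restrict (subset_univ (gap V v))) ?_ ?_ ?_ ?_ ?_).symm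
  · intro p hp
    simp only [Finset.mem_pi, mem_filter, mem_univ, true_and] at hp
    exact mem_filter.2 ⟨mem_NC.2 (isNoncrossing_gluePartition hp),
      mem_parts_gluePartition.2 (.inl rfl)⟩
  · intro σ hσ
    rw [mem_filter, mem_NC] at hσ
    refine Finset.mem_pi.2 fun v hv => mem_filter.2 ⟨mem_univ _, ?_⟩
    intro a b c d hab hbc hcd A hA B hB
    exact hσ.1 a b c d hab hbc hcd A ((mem_parts_restrict_gap hσ.1 hσ.2 hv).1 hA).1
      B ((mem_parts_restrict_gap hσ.1 hσ.2 hv).1 hB).1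
  · intro p hp
    simp only [Finset.mem_pi, mem_filter, mem_univ, true_and] at hp
    exact funext₂ fun v hv => restrict_gluePartition hp hv
  · intro σ hσ
    rw [mem_filter, mem_NC] at hσ
    exact gluePartition_restrict hσ.1 hσ.2
  · exact fun p _ => (prod_parts_gluePartition_erase f).symm

theorem sum_NC_blockDeriv (r s : ℕ → ℝ) :
    ∑ σ ∈ NC n, blockDeriv r s σ =
      ∑ V : Finset (Fin n) with V.Nonempty,
        s #V * blockProd (fun k => momentOfCumulant r (k - 1)) (runPartition V) := by
  have hparts (σ : SetPartition n) : blockDeriv r s σ =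
      ∑ V : Finset (Fin n) with V.Nonempty,
        if V ∈ σ.parts then s #V * ∏ B ∈ σ.parts.erase V, r #B else 0 := by
    rw [blockDeriv, ← sum_filter, filter_filter]
    refine sum_congr (Finset.ext fun V => ?_) fun _ _ => rfl
    simpa only [mem_filter, mem_univ, true_and] using
      ⟨fun h => ⟨σ.nonempty_of_mem_parts h, h⟩, And.right⟩
  simp only [hparts]
  rw [sum_comm]
  refine sum_congr rfl fun V hV => ?_
  replace hV := (mem_filter.1 hV).2
  rw [← sum_filter, ← mul_sum, sum_NC_prod_parts_erase hV (fun B => r #B), blockProd,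
    prod_parts_runPartition hV]
  simp only [sum_noncrossing_finpartition, card_gap]

end MarkedBlock

/-! ### Sums over cyclic decompositions -/

section CyclicSum

variable {n j : ℕ} {V : Finset (Fin n)} {i v w x y z : Fin n}

lemma mem_part_runPartition_of_lt (hx : x ∈ V) (hv : v ∈ V) (hxv : x < v) :
    i ∈ (runPartition V).part v ↔ i ≤ v ∧ ∀ w ∈ V, w < v → w < i := by
  rw [mem_part_iff, part_runPartition_eq_iff]
  constructor
  · intro h
    exact ⟨((h x hx v hv).2 ⟨hxv, le_rfl⟩).2, fun w hw hwv => ((h w hw v hv).2 ⟨hwv, le_rfl⟩).1⟩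
  · rintro ⟨hiv, hi⟩ w hw w' hw'
    exact ⟨fun h => ⟨h.1.trans_le hiv, not_lt.1 fun hw'v => (hi w' hw' hw'v).not_ge h.2⟩,
      fun h => ⟨hi w hw h.1, hiv.trans h.2⟩⟩

/-- The `(j + 1)`-element sets with minimum `x` and maximum `y`; they encode the compositions of
`y - x` into `j` positive parts. -/
def chains (j : ℕ) (x y : Fin n) : Finset (Finset (Fin n)) :=
  {V | #V = j + 1 ∧ x ∈ V ∧ y ∈ V ∧ V ⊆ Icc x y}

lemma mem_chains : V ∈ chains j x y ↔ #V = j + 1 ∧ x ∈ V ∧ y ∈ V ∧ V ⊆ Icc x y := by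
  simp only [chains, mem_filter, mem_univ, true_and]

lemma le_of_mem_chains (hV : V ∈ chains j x y) : x ≤ y :=
  (mem_Icc.1 ((mem_chains.1 hV).2.2.2 (mem_chains.1 hV).2.2.1)).1

lemma notMem_of_mem_chains (hV : V ∈ chains j x z) (hzy : z < y) : y ∉ V := fun hy =>
  (mem_Icc.1 ((mem_chains.1 hV).2.2.2 hy)).2.not_gt hzy

lemma insert_mem_chains (hV : V ∈ chains j x z) (hzy : z < y) :
    insert y V ∈ chains (j + 1) x y := by
  have hxz := le_of_mem_chains hV
  have hyV := notMem_of_mem_chains hV hzy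
  obtain ⟨hcard, hx, -, hsub⟩ := mem_chains.1 hV
  refine mem_chains.2 ⟨by rw [card_insert_of_notMem hyV, hcard], mem_insert_of_mem hx,
    mem_insert_self y V, insert_subset (mem_Icc.2 ⟨hxz.trans hzy.le, le_rfl⟩) ?_⟩
  exact hsub.trans (Icc_subset_Icc_right hzy.le)

lemma exists_insert_eq_of_mem_chains (hV : V ∈ chains (j + 1) x y) :
    ∃ z < y, ∃ U ∈ chains j x z, insert y U = V := by
  obtain ⟨hcard, hx, hy, hsub⟩ := mem_chains.1 hV
  have hcard' : #(V.erase y) = j + 1 := by rw [card_erase_of_mem hy, hcard, Nat.add_sub_cancel]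
  have hne : (V.erase y).Nonempty := card_pos.1 (hcard' ▸ j.succ_pos)
  set z := (V.erase y).max' hne
  have hz : z ∈ V.erase y := max'_mem _ hne
  have hzy : z < y :=
    lt_of_le_of_ne (mem_Icc.1 (hsub (mem_of_mem_erase hz))).2 (ne_of_mem_erase hz)
  have hxy : x ≠ y := fun h => hzy.not_ge (h ▸ (mem_Icc.1 (hsub (mem_of_mem_erase hz))).1)
  refine ⟨z, hzy, V.erase y, mem_chains.2 ⟨hcard', mem_erase.2 ⟨hxy, hx⟩, hz, fun v hv => ?_⟩,
    insert_erase hy⟩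
  exact mem_Icc.2 ⟨(mem_Icc.1 (hsub (mem_of_mem_erase hv))).1, le_max' _ v hv⟩

lemma sum_chains_succ {M : Type*} [AddCommMonoid M] (f : Finset (Fin n) → M) :
    ∑ V ∈ chains (j + 1) x y, f V = ∑ z ∈ Iio y, ∑ V ∈ chains j x z, f (insert y V) := by
  rw [sum_sigma']
  symm
  refine sum_nbij (fun U : (_ : Fin n) × Finset (Fin n) => insert y U.2) ?_ ?_ ?_ fun _ _ => rfl
  · rintro ⟨z, V⟩ h
    rw [mem_sigma, mem_Iio] at h
    exact insert_mem_chains h.2 h.1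
  · rintro ⟨z, V⟩ h ⟨z', V'⟩ h' heq
    rw [mem_coe, mem_sigma, mem_Iio] at h h'
    dsimp only at h h' heq
    obtain rfl : V = V' := by
      rw [← erase_insert (notMem_of_mem_chains h.2 h.1), heq,
        erase_insert (notMem_of_mem_chains h'.2 h'.1)]
    obtain ⟨⟨-, -, hz, hsub⟩, -, -, hz', hsub'⟩ := And.intro (mem_chains.1 h.2) (mem_chains.1 h'.2)
    obtain rfl : z = z' := le_antisymm (mem_Icc.1 (hsub' hz)).2 (mem_Icc.1 (hsub hz')).2
    rfl
  · intro V hV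
    obtain ⟨z, hzy, U, hU, rfl⟩ := exists_insert_eq_of_mem_chains hV
    exact ⟨⟨z, U⟩, mem_coe.2 (mem_sigma.2 ⟨mem_Iio.2 hzy, hU⟩), rfl⟩

lemma prod_runs_insert (u : ℕ → ℝ) (hV : V ∈ chains j x z) (hzy : z < y) :
    ∏ v ∈ (insert y V).erase x, u #((runPartition (insert y V)).part v) =
      (∏ v ∈ V.erase x, u #((runPartition V).part v)) * u (y - z) := by
  have hyV := notMem_of_mem_chains hV hzy
  have hxy : x < y := (le_of_mem_chains hV).trans_lt hzy
  obtain ⟨-, hx, hz, hsub⟩ := mem_chains.1 hV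
  have hrun_top : (runPartition (insert y V)).part y = Ioc z y := by
    ext i
    rw [mem_part_runPartition_of_lt (mem_insert_of_mem hx) (mem_insert_self y V) hxy, mem_Ioc,
      and_comm]
    refine and_congr_left fun _ => ⟨fun h => h z (mem_insert_of_mem hz) hzy, fun h w hw hwy => ?_⟩
    exact (mem_Icc.1 (hsub (mem_of_mem_insert_of_ne hw hwy.ne))).2.trans_lt h
  have hrun {v : Fin n} (hv : v ∈ V.erase x) :
      (runPartition (insert y V)).part v = (runPartition V).part v := by
    obtain ⟨hvx, hv⟩ := mem_erase.1 hv
    have hxv : x < v := lt_of_le_of_ne (mem_Icc.1 (hsub hv)).1 hvx.symm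
    have hvy : v < y := (mem_Icc.1 (hsub hv)).2.trans_lt hzy
    ext i
    rw [mem_part_runPartition_of_lt (mem_insert_of_mem hx) (mem_insert_of_mem hv) hxv,
      mem_part_runPartition_of_lt hx hv hxv, forall_mem_insert]
    exact and_congr_right fun _ => and_iff_right fun h => absurd h hvy.not_gt
  rw [erase_insert_of_ne hxy.ne', prod_insert fun h => hyV (mem_of_mem_erase h), hrun_top,
    Fin.card_Ioc, mul_comm]
  exact congrArg (· * _) (prod_congr rfl fun v hv => by rw [hrun hv])

lemma chains_zero_self (x : Fin n) : chains 0 x x = {{x}} := by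
  ext V
  rw [mem_chains, mem_singleton, Icc_self]
  constructor
  · exact fun h => h.2.2.2.antisymm (singleton_subset_iff.2 h.2.1)
  · rintro rfl
    exact ⟨card_singleton x, mem_singleton_self x, mem_singleton_self x, Subset.rfl⟩

lemma chains_zero_of_ne (hxy : x ≠ y) : chains 0 x y = ∅ :=
  eq_empty_of_forall_notMem fun V hV => by
    obtain ⟨hcard, hx, hy, -⟩ := mem_chains.1 hV
    exact hxy (card_le_one.1 hcard.le x hx y hy)

lemma coeff_mul_momentSeries (g : ℝ⟦X⟧) (u : ℕ → ℝ) (d : ℕ) :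
    PowerSeries.coeff d (g * momentSeries u) =
      ∑ k ∈ range d, PowerSeries.coeff k g * u (d - k) := by
  rw [PowerSeries.coeff_mul, Nat.sum_antidiagonal_eq_sum_range_succ fun a b =>
    PowerSeries.coeff a g * PowerSeries.coeff b (momentSeries u), sum_range_succ, Nat.sub_self,
    PowerSeries.coeff_zero_eq_constantCoeff_apply (momentSeries u), constantCoeff_momentSeries,
    mul_zero, add_zero]
  refine sum_congr rfl fun k hk => ?_
  obtain ⟨b, hb⟩ := Nat.exists_eq_add_one_of_ne_zero (Nat.sub_pos_of_lt (mem_range.1 hk)).ne'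
  rw [hb, coeff_succ_momentSeries]

lemma sum_Ico_eq_sum_range_sub (f : ℕ → ℕ → ℝ) (x y : Fin n) :
    ∑ z ∈ Ico x y, f (z - x) (y - z) = ∑ k ∈ range (y - x), f k (y - x - k) := by
  refine sum_bij (fun z _ => (z : ℕ) - x) (fun z hz => ?_) (fun z hz z' hz' h => ?_)
    (fun k hk => ?_) fun z hz => ?_
  all_goals simp only [mem_Ico, mem_range, Fin.le_def, Fin.lt_def] at *
  · omega
  · exact Fin.ext (by omega)
  · exact ⟨⟨x + k, by omega⟩, by simp only; omega, Nat.add_sub_cancel_left ..⟩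
  · congr 1
    omega

lemma sum_chains_prod_runs (u : ℕ → ℝ) (hxy : x ≤ y) :
    ∑ V ∈ chains j x y, ∏ v ∈ V.erase x, u #((runPartition V).part v) =
      PowerSeries.coeff (y - x) (momentSeries u ^ j) := by
  induction j generalizing y with
  | zero =>
    rw [pow_zero, PowerSeries.coeff_one]
    rcases hxy.eq_or_lt with rfl | hlt
    · rw [chains_zero_self, sum_singleton, erase_singleton, prod_empty, if_pos (Nat.sub_self _)]
    · rw [chains_zero_of_ne hlt.ne, sum_empty, if_neg (Nat.sub_pos_of_lt hlt).ne']
  | succ j ih =>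
    have hbelow : ∀ z ∈ Iio y, z ∉ Ico x y → ∑ V ∈ chains j x z,
        ∏ v ∈ (insert y V).erase x, u #((runPartition (insert y V)).part v) = 0 := by
      intro z hzy hz
      refine sum_eq_zero fun V hV => absurd ?_ hz
      exact mem_Ico.2 ⟨le_of_mem_chains hV, mem_Iio.1 hzy⟩
    rw [sum_chains_succ, ← sum_subset Ico_subset_Iio_self hbelow, pow_succ, coeff_mul_momentSeries,
      ← sum_Ico_eq_sum_range_sub fun a b => PowerSeries.coeff a (momentSeries u ^ j) * u b]
    refine sum_congr rfl fun z hz => ?_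
    obtain ⟨hxz, hzy⟩ := mem_Ico.1 hz
    rw [← ih hxz, sum_mul]
    exact sum_congr rfl fun V hV => prod_runs_insert u hV hzy

lemma card_part_runPartition_min (hV : V ∈ chains j x y) :
    #((runPartition V).part x) = n - (y - x) := by
  obtain ⟨-, hx, hy, hsub⟩ := mem_chains.1 hV
  have hrun : (runPartition V).part x = (Ioc x y)ᶜ := by
    ext i
    rw [mem_part_iff, part_runPartition_eq_iff, mem_compl, mem_Ioc]
    constructor
    · exact fun h hi => lt_irrefl x ((h x hx y hy).1 hi).1
    · refine fun hi w hw w' hw' => iff_of_false (fun h => hi ?_) fun h => ?_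
      · exact ⟨(mem_Icc.1 (hsub hw)).1.trans_lt h.1, h.2.trans (mem_Icc.1 (hsub hw')).2⟩
      · exact (mem_Icc.1 (hsub hw)).1.not_gt h.1
  rw [hrun, card_compl, Fintype.card_fin, Fin.card_Ioc]

lemma blockProd_runPartition_of_mem_chains (u : ℕ → ℝ) (hV : V ∈ chains j x y) :
    blockProd u (runPartition V) =
      u (n - (y - x)) * ∏ v ∈ V.erase x, u #((runPartition V).part v) := by
  have hx := (mem_chains.1 hV).2.1
  rw [blockProd, prod_parts_runPartition ⟨x, hx⟩ fun B => u #B, ← mul_prod_erase V _ hx,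
    card_part_runPartition_min hV]

lemma mem_chains_min'_max' (hV : V.Nonempty) (hcard : #V = j + 1) :
    V ∈ chains j (V.min' hV) (V.max' hV) :=
  mem_chains.2 ⟨hcard, min'_mem _ _, max'_mem _ _, fun v hv =>
    mem_Icc.2 ⟨min'_le V v hv, le_max' V v hv⟩⟩

lemma eq_of_mem_chains (hV : V ∈ chains j x y) (hV' : V ∈ chains j w z) : x = w ∧ y = z := by
  obtain ⟨-, hx, hy, hsub⟩ := mem_chains.1 hV
  obtain ⟨-, hw, hz, hsub'⟩ := mem_chains.1 hV'
  exact ⟨le_antisymm (mem_Icc.1 (hsub hw)).1 (mem_Icc.1 (hsub' hx)).1,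
    le_antisymm (mem_Icc.1 (hsub' hy)).2 (mem_Icc.1 (hsub hz)).2⟩

lemma sum_card_eq_sum_chains {M : Type*} [AddCommMonoid M] (j : ℕ) (f : Finset (Fin n) → M) :
    ∑ V : Finset (Fin n) with #V = j + 1, f V = ∑ y, ∑ x ∈ Iic y, ∑ V ∈ chains j x y, f V := by
  simp only [sum_sigma']
  refine (sum_nbij (fun V : (_ : Fin n) × (_ : Fin n) × Finset (Fin n) => V.2.2)
    ?_ ?_ ?_ fun _ _ => rfl).symm
  · rintro ⟨y, x, V⟩ h
    simp only [mem_sigma, mem_univ, true_and] at h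
    exact mem_filter.2 ⟨mem_univ V, (mem_chains.1 h.2).1⟩
  · rintro ⟨y, x, V⟩ h ⟨y', x', V'⟩ h' (rfl : V = V')
    simp only [mem_coe, mem_sigma, mem_univ, true_and] at h h'
    obtain ⟨rfl, rfl⟩ := eq_of_mem_chains h.2 h'.2
    rfl
  · intro V hV
    have hcard : #V = j + 1 := (mem_filter.1 hV).2
    have hne : V.Nonempty := card_pos.1 (hcard ▸ j.succ_pos)
    have hchain := mem_chains_min'_max' hne hcard
    refine ⟨⟨V.max' hne, V.min' hne, V⟩, ?_, rfl⟩
    simp only [mem_coe, mem_sigma, mem_univ, true_and]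
    exact ⟨mem_Iic.2 (le_of_mem_chains hchain), hchain⟩

lemma sum_Iic_eq_sum_range_mul (g : ℕ → ℝ) (n : ℕ) :
    ∑ y : Fin n, ∑ x ∈ Iic y, g (y - x) = ∑ d ∈ range n, (n - d : ℕ) * g d := by
  have hfiber (y : Fin n) : ∑ x ∈ Iic y, g (y - x) = ∑ d ∈ range (y + 1), g d := by
    refine sum_bij (fun x _ => (y : ℕ) - x) (fun x hx => ?_) (fun x hx x' hx' h => ?_)
      (fun d hd => ?_) fun _ _ => rfl
    all_goals simp only [mem_Iic, mem_range, Fin.le_def] at *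
    · omega
    · exact Fin.ext (by omega)
    · exact ⟨⟨y - d, by omega⟩, by simp only; omega, by simp only; omega⟩
  simp only [hfiber]
  clear hfiber
  rw [Fin.sum_univ_eq_sum_range (fun y => ∑ d ∈ range (y + 1), g d)]
  induction n with
  | zero => rfl
  | succ n ih =>
    rw [sum_range_succ, ih, sum_range_succ _ n, sum_range_succ _ n, ← add_assoc,
      ← sum_add_distrib]
    congr 1
    · refine sum_congr rfl fun d hd => ?_
      rw [Nat.sub_add_comm (mem_range.1 hd).le, Nat.cast_add_one, add_one_mul]
    · rw [Nat.add_sub_cancel_left, Nat.cast_one, one_mul]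

lemma sum_card_eq_blockProd_runPartition (u : ℕ → ℝ) (n j : ℕ) :
    ∑ V : Finset (Fin (n + 1)) with #V = j + 1, blockProd u (runPartition V) =
      PowerSeries.coeff n (momentSeries u ^ j * PowerSeries.derivative ℝ (momentSeries u)) := by
  let g (d : ℕ) : ℝ := u (n + 1 - d) * PowerSeries.coeff d (momentSeries u ^ j)
  have hchains (y x : Fin (n + 1)) (hx : x ∈ Iic y) :
      ∑ V ∈ chains j x y, blockProd u (runPartition V) = g (y - x) := by
    rw [sum_congr rfl fun V hV => blockProd_runPartition_of_mem_chains u hV, ← mul_sum,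
      sum_chains_prod_runs u (mem_Iic.1 hx)]
  rw [sum_card_eq_sum_chains, sum_congr rfl fun y _ => sum_congr rfl (hchains y),
    sum_Iic_eq_sum_range_mul g, PowerSeries.coeff_mul,
    Nat.sum_antidiagonal_eq_sum_range_succ fun a b => PowerSeries.coeff a (momentSeries u ^ j) *
      PowerSeries.coeff b (PowerSeries.derivative ℝ (momentSeries u))]
  refine sum_congr rfl fun d hd => ?_
  rw [PowerSeries.coeff_derivative, coeff_succ_momentSeries, ← Nat.cast_add_one,
    ← Nat.sub_add_comm (mem_range_succ_iff.1 hd)]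
  ring

theorem sum_mul_blockProd_runPartition (c u : ℕ → ℝ) (n : ℕ) :
    ∑ V : Finset (Fin (n + 1)) with V.Nonempty, c #V * blockProd u (runPartition V) =
      PowerSeries.coeff n ((PowerSeries.mk fun k => c (k + 1)).subst (momentSeries u) *
        PowerSeries.derivative ℝ (momentSeries u)) := by
  have hmaps : ∀ V ∈ ({V | V.Nonempty} : Finset (Finset (Fin (n + 1)))),
      #V - 1 ∈ range (n + 1) := fun V hV => by
    have := card_finset_fin_le V
    have := card_pos.2 (mem_filter.1 hV).2
    exact mem_range.2 (by omega)
  rw [coeff_subst_mul (constantCoeff_momentSeries u), ← sum_fiberwise_of_maps_to hmaps]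
  refine sum_congr rfl fun j _ => ?_
  rw [PowerSeries.coeff_mk, ← sum_card_eq_blockProd_runPartition, mul_sum, filter_filter]
  refine sum_congr (filter_congr fun V _ => ?_) fun V hV => ?_
  · rw [← card_pos]
    omega
  · rw [(mem_filter.1 hV).2]

end CyclicSum

/-! ### The infinitesimal moment-cumulant formula for power series -/

section MomentSeries

variable (r s c : ℕ → ℝ) {n : ℕ}

lemma sum_NC_succ_blockDeriv (n : ℕ) :
    ∑ σ ∈ NC (n + 1), blockDeriv r s σ =
      PowerSeries.coeff n ((PowerSeries.mk fun k => s (k + 1)).subst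
        (momentSeries fun k => momentOfCumulant r (k - 1)) *
          PowerSeries.derivative ℝ (momentSeries fun k => momentOfCumulant r (k - 1))) :=
  (sum_NC_blockDeriv r s).trans (sum_mul_blockProd_runPartition s _ n)

lemma blockDeriv_natCast_mul (π : SetPartition n) :
    blockDeriv r (fun k => k * r k) π = n * blockProd r π := by
  have hcard : ∑ V ∈ π.parts, (#V : ℝ) = n := by
    rw [← Nat.cast_sum, π.sum_card_parts, card_univ, Fintype.card_fin]
  rw [blockDeriv, ← hcard, sum_mul]
  refine sum_congr rfl fun V hV => ?_
  rw [mul_assoc, blockProd, mul_prod_erase π.parts (fun W => r #W) hV]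

lemma derivative_momentSeries :
    PowerSeries.derivative ℝ (momentSeries r) =
      PowerSeries.mk fun k => ((k + 1 : ℕ) : ℝ) * r (k + 1) := by
  ext k
  rw [PowerSeries.coeff_derivative, coeff_succ_momentSeries, PowerSeries.coeff_mk, mul_comm,
    Nat.cast_add_one]

/-- Euler's trick: for `s_k = k r_k` the infinitesimal moments are `n m_n`, as the block sizes of a
partition of `[n]` add up to `n`, so both sides have the same derivative. -/
lemma momentSeries_momentOfCumulant :
    momentSeries (momentOfCumulant r) =
      (momentSeries r).subst (momentSeries fun k => momentOfCumulant r (k - 1)) := by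
  have hsubst := PowerSeries.HasSubst.of_constantCoeff_zero'
    (constantCoeff_momentSeries fun k => momentOfCumulant r (k - 1))
  refine PowerSeries.derivative.ext ?_ ?_
  · ext n
    rw [PowerSeries.derivative_subst hsubst, derivative_momentSeries r,
      ← sum_NC_succ_blockDeriv r (fun k => k * r k), derivative_momentSeries, PowerSeries.coeff_mk,
      momentOfCumulant, mul_sum]
    exact sum_congr rfl fun π _ => (blockDeriv_natCast_mul r π).symm
  · exact (constantCoeff_momentSeries _).trans (PowerSeries.constantCoeff_subst_eq_zero
      (constantCoeff_momentSeries _) _ (constantCoeff_momentSeries r)).symm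

theorem sum_NC_blockDeriv_sum_runPartition (n : ℕ) :
    ∑ σ ∈ NC (n + 1), blockDeriv r (fun k =>
        ∑ W : Finset (Fin k) with W.Nonempty, c #W * blockProd r (runPartition W)) σ =
      PowerSeries.coeff n ((PowerSeries.mk fun k => c (k + 1)).subst
        (momentSeries (momentOfCumulant r)) *
          PowerSeries.derivative ℝ (momentSeries (momentOfCumulant r))) := by
  have hsubst := PowerSeries.HasSubst.of_constantCoeff_zero'
    (constantCoeff_momentSeries fun k => momentOfCumulant r (k - 1))
  have hsubst' := PowerSeries.HasSubst.of_constantCoeff_zero' (constantCoeff_momentSeries r)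
  rw [sum_NC_succ_blockDeriv, momentSeries_momentOfCumulant, PowerSeries.derivative_subst hsubst,
    ← PowerSeries.subst_comp_subst_apply hsubst' hsubst, ← mul_assoc,
    ← PowerSeries.subst_mul hsubst]
  congr 3
  ext k
  rw [PowerSeries.coeff_mk, sum_mul_blockProd_runPartition]

lemma momentSeries_congr {m m' : ℕ → ℝ} (h : ∀ n, n ≠ 0 → m n = m' n) :
    momentSeries m = momentSeries m' :=
  congrArg (PowerSeries.X * ·) (PowerSeries.ext fun n => by
    rw [PowerSeries.coeff_mk, PowerSeries.coeff_mk, h _ n.succ_ne_zero])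

end MomentSeries

/-! ### Convolution with an infinitesimal distribution at `δ₁` -/

section DiracOne

variable {μ γ : Measure ℝ} {μ' ν' γ' : ℝ[X] →ₗ[ℝ] ℝ}

lemma measureMoment_zero (μ : Measure ℝ) [IsProbabilityMeasure μ] : measureMoment μ 0 = 1 := by
  simp only [measureMoment, pow_zero, integral_const, probReal_univ, one_smul]

lemma measureMoment_eq_iff [IsProbabilityMeasure μ] [IsProbabilityMeasure γ] :
    measureMoment γ = measureMoment μ ↔ ∀ n, n ≠ 0 → freeCumulants γ n = freeCumulants μ n := by
  refine ⟨fun h n _ => by rw [freeCumulants, freeCumulants, h], fun h => funext fun n => ?_⟩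
  rcases eq_or_ne n 0 with rfl | hn
  · rw [measureMoment_zero, measureMoment_zero]
  · rw [moment_eq_sum_freeCumulant (measureMoment γ) hn,
      moment_eq_sum_freeCumulant (measureMoment μ) hn]
    exact sum_congr rfl fun π _ => blockProd_congr h π

lemma infFreeCumulant_eq_iff {m m' c : ℕ → ℝ} :
    (∀ n, n ≠ 0 → infFreeCumulant m m' n = c n) ↔
      ∀ n, n ≠ 0 → m' n = ∑ π ∈ NC n, blockDeriv (freeCumulant m) c π := by
  refine ⟨fun h n hn => ?_, fun h n hn => infFreeCumulant_eq h hn⟩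
  rw [infMoment_eq_sum_infFreeCumulant m m' hn]
  exact sum_congr rfl fun π _ => blockDeriv_congr_right h _ π

lemma isInfFreeMulConv_dirac_one_iff_cumulants (hν' : ν' 1 = 0) :
    IsInfFreeMulConv μ μ' (.dirac 1) ν' γ γ' ↔ IsInfDistribution γ γ' ∧
      (∀ n, n ≠ 0 → freeCumulants γ n = freeCumulants μ n) ∧
      ∀ n, n ≠ 0 → infFreeCumulants γ γ' n = infFreeCumulants μ μ' n +
        ∑ W : Finset (Fin n) with W.Nonempty,
          ν' ((X - 1) ^ #W) * blockProd (freeCumulants μ) (runPartition W) := by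
  have hcum (n : ℕ) (hn : n ≠ 0) : ∑ π ∈ NC n, blockProd (freeCumulants μ) π *
      blockProd (freeCumulants (.dirac 1)) (kreweras π) = freeCumulants μ n := by
    simp only [blockProd_congr fun _ => freeCumulants_dirac_one]
    rw [sum_NC_mul_blockProd_kreweras_single_one hn, blockProd_top hn]
  have hinf (n : ℕ) (hn : n ≠ 0) : ∑ π ∈ NC n, (blockDeriv (freeCumulants μ)
      (infFreeCumulants μ μ') π * blockProd (freeCumulants (.dirac 1)) (kreweras π) +
        blockProd (freeCumulants μ) π * blockDeriv (freeCumulants (.dirac 1))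
          (infFreeCumulants (.dirac 1) ν') (kreweras π)) = infFreeCumulants μ μ' n +
        ∑ W : Finset (Fin n) with W.Nonempty,
          ν' ((X - 1) ^ #W) * blockProd (freeCumulants μ) (runPartition W) := by
    simp only [blockProd_congr fun _ => freeCumulants_dirac_one,
      blockDeriv_congr_left fun _ => freeCumulants_dirac_one,
      blockDeriv_congr_right fun _ => infFreeCumulants_dirac_one hν', sum_add_distrib]
    rw [sum_NC_mul_blockProd_kreweras_single_one hn, blockDeriv_top hn,
      sum_NC_mul_blockDeriv_kreweras_single_one]
  simp only [← Nat.one_le_iff_ne_zero] at hcum hinf ⊢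
  constructor
  · rintro ⟨⟨-, hprob, hint, hr⟩, hone, hr'⟩
    exact ⟨⟨hprob, hint, hone⟩, fun n hn => (hr n hn).trans (hcum n hn),
      fun n hn => (hr' n hn).trans (hinf n hn)⟩
  · rintro ⟨⟨hprob, hint, hone⟩, hr, hr'⟩
    exact ⟨⟨by simp, hprob, hint, fun n hn => (hr n hn).trans (hcum n hn).symm⟩, hone,
      fun n hn => (hr' n hn).trans (hinf n hn).symm⟩

theorem isInfFreeMulConv_dirac_one_iff (hμ : IsInfDistribution μ μ') (hν' : ν' 1 = 0) :
    IsInfFreeMulConv μ μ' (.dirac 1) ν' γ γ' ↔ IsInfDistribution γ γ' ∧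
      measureMoment γ = measureMoment μ ∧
      ∀ n, functionalMoment γ' (n + 1) = functionalMoment μ' (n + 1) +
        PowerSeries.coeff n ((PowerSeries.mk fun k => ν' ((X - 1) ^ (k + 1))).subst
          (momentSeries (measureMoment μ)) *
            PowerSeries.derivative ℝ (momentSeries (measureMoment μ))) := by
  rw [isInfFreeMulConv_dirac_one_iff_cumulants hν']
  refine and_congr_right fun hγ => ?_
  have := hμ.isProbabilityMeasure
  have := hγ.isProbabilityMeasure
  rw [← measureMoment_eq_iff]
  refine and_congr_right fun hmoment => ?_
  have hψ : momentSeries (measureMoment μ) = momentSeries (momentOfCumulant (freeCumulants μ)) :=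
    momentSeries_congr fun n hn => moment_eq_sum_freeCumulant _ hn
  simp only [infFreeCumulants, infFreeCumulant_eq_iff, hmoment]
  rw [← Nat.and_forall_add_one]
  simp only [ne_eq, not_true, false_imp_iff, true_and, Nat.add_one_ne_zero, not_false_eq_true,
    forall_const]
  refine forall_congr' fun n => ?_
  rw [hψ, ← sum_NC_blockDeriv_sum_runPartition (freeCumulants μ) fun k => ν' ((X - 1) ^ k),
    infMoment_eq_sum_infFreeCumulant (measureMoment μ) (functionalMoment μ') n.succ_ne_zero,
    ← sum_add_distrib]
  exact Eq.congr_right (sum_congr rfl fun π _ => blockDeriv_add _ _ _ π)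

/-- The linear functional on polynomials with moments `c n`. -/
noncomputable def functionalOfMoments (c : ℕ → ℝ) : ℝ[X] →ₗ[ℝ] ℝ :=
  Polynomial.lsum fun n => c n • LinearMap.id

lemma functionalMoment_functionalOfMoments (c : ℕ → ℝ) (n : ℕ) :
    functionalMoment (functionalOfMoments c) n = c n := by
  rw [functionalMoment, functionalOfMoments, Polynomial.lsum_apply, Polynomial.X_pow_eq_monomial,
    Polynomial.sum_monomial_index _ _ (map_zero (c n • LinearMap.id)), LinearMap.smul_apply,
    LinearMap.id_apply, smul_eq_mul, mul_one]

theorem exists_isInfFreeMulConv_dirac_one (hμ : IsInfDistribution μ μ') (hν' : ν' 1 = 0) :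
    ∃ γ γ', IsInfFreeMulConv μ μ' (.dirac 1) ν' γ γ' := by
  let c (n : ℕ) : ℝ := functionalMoment μ' (n + 1) +
    PowerSeries.coeff n ((PowerSeries.mk fun k => ν' ((X - 1) ^ (k + 1))).subst
      (momentSeries (measureMoment μ)) *
        PowerSeries.derivative ℝ (momentSeries (measureMoment μ)))
  have hmoment := functionalMoment_functionalOfMoments fun n => n.casesOn 0 c
  refine ⟨μ, functionalOfMoments fun n => n.casesOn 0 c,
    (isInfFreeMulConv_dirac_one_iff hμ hν').2 ⟨⟨hμ.1, hμ.2, ?_⟩, rfl, fun n => hmoment (n + 1)⟩⟩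
  rw [← pow_zero X]
  exact hmoment 0

theorem HasInfDistribution.finiteFreeMulConv {p q : ℕ → ℝ[X]}
    (hp : ∀ d, 1 ≤ d → (p d).IsMonicOfDegree d) (hq : ∀ d, 1 ≤ d → (q d).IsMonicOfDegree d)
    (hpμ : HasInfDistribution p μ μ') (hqν : HasInfDistribution q (.dirac 1) ν')
    (hγ : IsInfFreeMulConv μ μ' (.dirac 1) ν' γ γ') :
    HasInfDistribution (fun d => finiteFreeMulConv d (p d) (q d)) γ γ' := by
  obtain ⟨hdist, hmoment, hinf⟩ :=
    (isInfFreeMulConv_dirac_one_iff hpμ.isInfDistribution hqν.isInfDistribution.map_one).1 hγ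
  exact hpμ.of_tendsto_newtonSeries_sub hp
    (fun d hd => isMonicOfDegree_finiteFreeMulConv (hp d hd) (hq d hd))
    (tendsto_newtonSeries_finiteFreeMulConv_sub hp hq (hpμ.tendsto_newtonSeries hp)
      (constantCoeff_momentSeries _) (hqν.tendsto_newtonSeries_taylor hq)) hdist hmoment hinf

end DiracOne

end FiniteFree

theorem mainTheorem11_general {p q : ℕ → ℝ[X]} (hp : ∀ d, 1 ≤ d → (p d).IsMonicOfDegree d)
    (hq : ∀ d, 1 ≤ d → (q d).IsMonicOfDegree d) {μ : Measure ℝ} {μ' ν' : ℝ[X] →ₗ[ℝ] ℝ}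
    (hpμ : FiniteFree.HasInfDistribution p μ μ')
    (hqν : FiniteFree.HasInfDistribution q (.dirac 1) ν') :
    (∃ γ γ', FiniteFree.IsInfFreeMulConv μ μ' (.dirac 1) ν' γ γ') ∧
      ∀ γ γ', FiniteFree.IsInfFreeMulConv μ μ' (.dirac 1) ν' γ γ' →
        FiniteFree.HasInfDistribution (fun d => FiniteFree.finiteFreeMulConv d (p d) (q d)) γ γ' :=
  ⟨FiniteFree.exists_isInfFreeMulConv_dirac_one hpμ.isInfDistribution
    hqν.isInfDistribution.map_one, fun _ _ => hpμ.finiteFreeMulConv hp hq hqν⟩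

theorem mainTheorem11
    (p q : ℕ → Polynomial ℝ)
    (hp : ∀ d : ℕ, 1 ≤ d → FiniteFree.IsRealRooted d (p d))
    (hq : ∀ d : ℕ, 1 ≤ d → FiniteFree.IsRealRooted d (q d))
    (μ ν : MeasureTheory.Measure ℝ)
    (μ' ν' : Polynomial ℝ →ₗ[ℝ] ℝ)
    (hpμ : FiniteFree.HasInfDistribution p μ μ')
    (hqν : FiniteFree.HasInfDistribution q ν ν')
    (hν : ν = MeasureTheory.Measure.dirac 1) :
    (∃ (γ : MeasureTheory.Measure ℝ) (γ' : Polynomial ℝ →ₗ[ℝ] ℝ),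
      FiniteFree.IsInfFreeMulConv μ μ' ν ν' γ γ') ∧
    ∀ (γ : MeasureTheory.Measure ℝ) (γ' : Polynomial ℝ →ₗ[ℝ] ℝ),
      FiniteFree.IsInfFreeMulConv μ μ' ν ν' γ γ' →
      FiniteFree.HasInfDistribution
        (fun d : ℕ => FiniteFree.finiteFreeMulConv d (p d) (q d)) γ γ' := by
  subst hν
  exact mainTheorem11_general (fun d hd => ⟨(hp d hd).natDegree_eq, (hp d hd).monic⟩)
    (fun d hd => ⟨(hq d hd).natDegree_eq, (hq d hd).monic⟩) hpμ hqν
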